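/- \textbf{Setting.} An intermediary connects one unit-demand buyer with $n$ sellers, each offering a distinct item. The buyer's values $v_i$ and the sellers' private costs $c_i$ are all independent, with distributions on $[0,\infty)$ given by densities $f_i$ (cdf $F_i$) and $g_i$ (cdf $G_i$), each positive exactly on an interval. Each $v_i$ has finite mean and is regular: the virtual value $\phi_i(v)=v-\frac{1-F_i(v)}{f_i(v)}$ is strictly increasing on the support interval (for instance, $v_i$ of finite mean with monotone hazard rate). The distribution of $-c_i$ has a monotone (non-decreasing) hazard rate; let $\theta_i(c)=c+\frac{G_i(c)}{g_i(c)}$ be the virtual cost. Write $\phi_i^{-1}(s)=\inf\{v:\ f_i(v)>0,\ \phi_i(v)\ge s\}$, with $\inf\emptyset=+\infty$. In the full-attention model the buyer sees prices $p_i\in(-\infty,+\infty]$ ($+\infty$ means that the item is not offered) and buys an item maximizing $v_i-p_i$ if this maximum is nonnegative, and nothing otherwise. Let $x_i(p)$ be the probability that he buys item $i$. For item costs $\theta\in\mathbb R^n$, the algorithmic pricing problem is to maximize $\sum_i x_i(p)(p_i-\theta_i)$ over $p$ (a term with $p_i=+\infty$ counts as $0$). The anonymous virtual reserve prices at $\theta$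 are $p_i(\theta)=\phi_i^{-1}(r+\theta_i)$, where $r=r(\theta)\ge 0$ is the (smallest) median of $\max\{0,\max_i(\phi_i(v_i)-\theta_i)\}$. A protocol maps the reported costs to (possibly randomized) buyer prices and expected transfers to the sellers. It is truthful if its expected revenue (the price paid by the buyer minus the transfers) is well defined and finite, reporting the true cost is a dominant strategy for every seller in expectation over the buyer's values and the protocol's randomness, and truthful sellers have nonnegative expected utility. A truthful protocol is an $\alpha$-approximation to the intermediation problem if its expected revenue is at least $\alpha$ times that of every truthful protocol. \textbf{Theorem.} \begin{enumerate} \item For every $\theta\in\mathbb R^n$, the prices $p(\theta)$ achieve at least $\frac12$ of the profit of every price vector $p\in(-\infty,+\infty]^n$ in the algorithmic pricing problem with item costs $\theta$. \item The pricing is monotone for the sellers: $x_i(p(\theta))$ is non-increasing in $\theta_i$ for every $i$, when the other $\theta_j$ are fixed. \item The mechanism that posts the prices $p(\theta_1(c_1),\dots,\theta_n(c_n))$ at reported costs $c$ and, when item $i$ is sold, pays its seller \[ c_i+\frac{1}{x_i(c)}\int_{\{u>c_i:\ g_i(u)>0\}}x_i(u,c_{-i})\,du, \] where $x_i(c)=x_i\big(p(\theta_1(c_1),\dots,\theta_n(c_n))\big)$,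 is truthful and is a $\frac12$-approximation to the intermediation problem. \end{enumerate} -/

import Mathlib

open MeasureTheory

namespace Intermediation

noncomputable section

/-! ### Distributions given by densities -/

/-- `f` is the density of a distribution on `[0, ∞)` which is positive exactly on an interval. -/
structure IsNonnegDensity (f : ℝ → ℝ) : Prop where
  measurable : Measurable f
  nonneg : ∀ z, 0 ≤ f z
  eq_zero_of_neg : ∀ z < 0, f z = 0
  integral_eq_one : ∫ z, f z = 1
  ordConnected : {z | 0 < f z}.OrdConnected

/-- The support interval of a density. -/
def supp (f : ℝ → ℝ) : Set ℝ := {z | 0 < f z}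

/-- The distribution with density `f`. -/
def dist (f : ℝ → ℝ) : Measure ℝ := volume.withDensity fun z => ENNReal.ofReal (f z)

/-- The cumulative distribution function of the distribution with density `f`. -/
def cdf (f : ℝ → ℝ) (z : ℝ) : ℝ := ∫ t in Set.Iic z, f t

/-- The hazard rate `f / (1 - F)`. -/
def hazardRate (f : ℝ → ℝ) (z : ℝ) : ℝ := f z / (1 - cdf f z)

/-- Monotone hazard rate: the hazard rate is non-decreasing (where it is defined). -/
def HasMHR (f : ℝ → ℝ) : Prop := MonotoneOn (hazardRate f) {z | cdf f z < 1}

/-- Myerson's virtual value `φ(v) = v - (1 - F(v)) / f(v)`. -/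
def virtualValue (f : ℝ → ℝ) (v : ℝ) : ℝ := v - (1 - cdf f v) / f v

/-- The virtual cost `θ(c) = c + F(c) / f(c)`. -/
def virtualCost (g : ℝ → ℝ) (c : ℝ) : ℝ := c + cdf g c / g c

/-- The inverse `φ⁻¹(s)` of the virtual value function: the smallest value in the support interval
at which the virtual value reaches `s`; it is `⊤` (the item cannot be sold) if there is none. -/
def virtualValueInv (f : ℝ → ℝ) (s : ℝ) : EReal :=
  sInf ((fun v : ℝ => (v : EReal)) '' {v | v ∈ supp f ∧ s ≤ virtualValue f v})

/-- The joint law of independent variables with densities `f i`. -/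
def jointDist {n : ℕ} (f : Fin n → ℝ → ℝ) : Measure (Fin n → ℝ) := Measure.pi fun i => dist (f i)

/-! ### The full-attention buyer and the algorithmic pricing problem -/

/-- Facing prices `p` (where `⊤` means that the item is not offered), the unit-demand buyer with
values `v` buys item `i`: it has non-negative surplus and maximizes the surplus over all items.
Ties, which have probability zero for values with densities, go to the smallest index. -/
def Buys {n : ℕ} (p : Fin n → EReal) (v : Fin n → ℝ) (i : Fin n) : Prop :=
  0 ≤ (v i : EReal) - p i ∧
  (∀ j, (v j : EReal) - p j ≤ (v i : EReal) - p i) ∧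
  ∀ j < i, (v j : EReal) - p j < (v i : EReal) - p i

/-- The probability that item `i` is bought at prices `p`. -/
def saleProb {n : ℕ} (f : Fin n → ℝ → ℝ) (p : Fin n → EReal) (i : Fin n) : ℝ :=
  (jointDist f).real {v | Buys p v i}

/-- The expected profit of posting the prices `p` when the sale of item `i` costs `θ i`: the
objective of the algorithmic pricing problem. -/
def pricingProfit {n : ℕ} (f : Fin n → ℝ → ℝ) (θ : Fin n → ℝ) (p : Fin n → EReal) : ℝ :=
  ∑ i, saleProb f p i * ((p i).toReal - θ i)

/-- The anonymous virtual reserve at costs `θ`: the median of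
`max (0, max_i (φ_i(v_i) - θ_i))`. -/
def virtualReserve {n : ℕ} (f : Fin n → ℝ → ℝ) (θ : Fin n → ℝ) : ℝ :=
  sInf {t : ℝ | 1 / 2 ≤
    (jointDist f).real {v | (⨆ i, max 0 (virtualValue (f i) (v i) - θ i)) ≤ t}}

/-- The prices of the anonymous virtual reserve `r` at costs `θ`: item `i` gets the price at which
its virtual value, net of its cost `θ i`, equals `r`. -/
def reservePrices {n : ℕ} (f : Fin n → ℝ → ℝ) (θ : Fin n → ℝ) (i : Fin n) : EReal :=
  virtualValueInv (f i) (virtualReserve f θ + θ i)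

/-! ### The intermediation problem -/

/-- An intermediation protocol for a full-attention buyer: from the reported costs `c` and a random
seed `ω`, uniform on `[0, 1]`, it computes the prices shown to the buyer, and it makes a transfer,
in expectation `pay c i`, to each seller `i`. -/
structure Protocol (n : ℕ) where
  price : unitInterval → (Fin n → ℝ) → Fin n → EReal
  pay : (Fin n → ℝ) → Fin n → ℝ

/-- The probability that item `i` is sold when the reported costs are `c`. -/
def Protocol.alloc {n : ℕ} (M : Protocol n) (f : Fin n → ℝ → ℝ) (c : Fin n → ℝ) (i : Fin n) : ℝ :=
  ((volume : Measure unitInterval).prod (jointDist f)).real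
    {q | Buys (M.price q.1 c) q.2 i}

open Classical in
/-- The intermediary's profit at seed `ω`, buyer values `v` and costs `c`: the price paid by the
buyer minus the transfers to the sellers. -/
def Protocol.profit {n : ℕ} (M : Protocol n) (q : unitInterval × (Fin n → ℝ) × (Fin n → ℝ)) : ℝ :=
  (∑ i, if Buys (M.price q.1 q.2.2) q.2.1 i then (M.price q.1 q.2.2 i).toReal else 0) -
    ∑ i, M.pay q.2.2 i

/-- The joint law of seed, buyer values (densities `f`) and costs (densities `g`). -/
def outcomeDist {n : ℕ} (f g : Fin n → ℝ → ℝ) :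
    Measure (unitInterval × (Fin n → ℝ) × (Fin n → ℝ)) :=
  (volume : Measure unitInterval).prod ((jointDist f).prod (jointDist g))

/-- The expected revenue of the intermediary when the sellers report their true costs. -/
def Protocol.revenue {n : ℕ} (M : Protocol n) (f g : Fin n → ℝ → ℝ) : ℝ :=
  ∫ q, M.profit q ∂outcomeDist f g

/-- The expected utility of seller `i` with true cost `c` when the reported costs are `b`. -/
def Protocol.sellerUtility {n : ℕ} (M : Protocol n) (f : Fin n → ℝ → ℝ) (i : Fin n) (c : ℝ)
    (b : Fin n → ℝ) : ℝ :=
  M.pay b i - M.alloc f b i * c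

/-- Truthful protocols: measurable with finite expected revenue, no price is `-∞`, reporting the
true cost is a dominant strategy for each seller, and truthful sellers do not lose by
participating. -/
structure Protocol.IsTruthful {n : ℕ} (M : Protocol n) (f g : Fin n → ℝ → ℝ) : Prop where
  measurable_price : Measurable fun q : unitInterval × (Fin n → ℝ) => M.price q.1 q.2
  measurable_pay : Measurable M.pay
  price_ne_bot : ∀ ω c i, M.price ω c i ≠ ⊥
  integrable_profit : Integrable M.profit (outcomeDist f g)
  dominant : ∀ c : Fin n → ℝ, (∀ j, c j ∈ supp (g j)) → ∀ i, ∀ b ∈ supp (g i),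
    M.sellerUtility f i (c i) (Function.update c i b) ≤ M.sellerUtility f i (c i) c
  participation : ∀ c : Fin n → ℝ, (∀ j, c j ∈ supp (g j)) → ∀ i,
    0 ≤ M.sellerUtility f i (c i) c

/-- `M` is an `α`-approximation to the intermediation problem: it is truthful, and its revenue is at
least `α` times the revenue of every truthful protocol. -/
def Protocol.IsApproximation {n : ℕ} (M : Protocol n) (f g : Fin n → ℝ → ℝ) (α : ℝ) : Prop :=
  M.IsTruthful f g ∧ ∀ M' : Protocol n, M'.IsTruthful f g → α * M'.revenue f g ≤ M.revenue f g

/-- The buyer prices of the anonymous virtual reserve mechanism at reported costs `c`. -/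
def mechPrices {n : ℕ} (f g : Fin n → ℝ → ℝ) (c : Fin n → ℝ) : Fin n → EReal :=
  reservePrices f fun i => virtualCost (g i) (c i)

/-- What the mechanism pays to seller `i` if item `i` is bought:
`c_i + (∫_{u > c_i} x_i(u, c_{-i}) du) / x_i(c)`, with `x_i` the probability of sale and `u` ranging
over the support of the cost of seller `i`. -/
def sellerPrice {n : ℕ} (f g : Fin n → ℝ → ℝ) (c : Fin n → ℝ) (i : Fin n) : ℝ :=
  c i + (∫ u in supp (g i) ∩ Set.Ioi (c i),
    saleProb f (mechPrices f g (Function.update c i u)) i) / saleProb f (mechPrices f g c) i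

/-- The anonymous virtual reserve mechanism: post the anonymous virtual reserve prices for the
virtual costs `θ_i(c_i)`, and pay the seller of the item that is bought. -/
def reserveMechanism {n : ℕ} (f g : Fin n → ℝ → ℝ) : Protocol n where
  price _ c := mechPrices f g c
  pay c i := saleProb f (mechPrices f g c) i * sellerPrice f g c i

end

end Intermediation

/-!
By Myerson's lemma, the profit of any prices is at most the expected virtual value, net of its
cost, of the item sold, hence at most `r + ∑ i, E[(φ_i(v_i) - θ_i - r)⁺]` for every `r ≥ 0`. Take
for `r` the median reserve. With probability at least `1/2` no other item is affordable, so each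
item sells at least half as often as it would alone, which pays for half of the sum; and if `r > 0`
then a sale, which is worth at least `r`, occurs with probability at least `1/2`. Raising `θ_i`
raises `r + θ_i` and lowers `r`, so that item `i` becomes more expensive and its competitors
cheaper, whence monotonicity.

Incentive compatibility forces the transfer to a seller to cover his cost and his information rent
`∫ u > c_i, x_i(u, c_{-i})`, and by Fubini cost and rent have the expectation of the virtual cost.
For the reserve mechanism this is an equality, and it is truthful because its allocation is
monotone. So its revenue is the expected profit of the reserve prices at the virtual costs, whereas
the revenue of any truthful protocol is at most the expected profit of its prices at these costs.
-/

namespace Intermediation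

open Set Filter Topology

/-! ### Expectations against a density -/

lemma lintegral_measure_prodMk_left_mul {α β : Type*} [MeasurableSpace α] [MeasurableSpace β]
    {μ : Measure α} {ν : Measure β} [SFinite μ] [SFinite ν] {R : Set (α × β)}
    (hR : MeasurableSet R) {h : α → ENNReal} (hh : Measurable h) :
    ∫⁻ u, ν {v | (u, v) ∈ R} * h u ∂μ = ∫⁻ v, (∫⁻ u in {u | (u, v) ∈ R}, h u ∂μ) ∂ν :=
  calc ∫⁻ u, ν {v | (u, v) ∈ R} * h u ∂μ
      = ∫⁻ u, (∫⁻ v, R.indicator (fun q => h q.1) (u, v) ∂ν) ∂μ :=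
        lintegral_congr fun u => by
          rw [mul_comm]
          exact (lintegral_indicator_const (measurable_prodMk_left hR) (h u)).symm
    _ = ∫⁻ v, (∫⁻ u, R.indicator (fun q => h q.1) (u, v) ∂μ) ∂ν :=
        lintegral_lintegral_swap ((hh.comp measurable_fst).indicator hR).aemeasurable
    _ = ∫⁻ v, (∫⁻ u in {u | (u, v) ∈ R}, h u ∂μ) ∂ν :=
        lintegral_congr fun v => lintegral_indicator (measurable_prodMk_right hR) h

lemma setIntegral_sub_eq_toReal_lintegral {μ : Measure ℝ} {S : Set ℝ} (hS : MeasurableSet S)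
    {p : ℝ} (hp : S ⊆ Ici p) :
    ∫ v in S, (v - p) ∂μ = (∫⁻ v in S, volume (Ioo p v) ∂μ).toReal := by
  rw [integral_eq_lintegral_of_nonneg_ae
    ((ae_restrict_iff' hS).2 (ae_of_all _ fun v hv => sub_nonneg.2 (hp hv)))
    (measurable_id.sub measurable_const).aestronglyMeasurable]
  simp only [Real.volume_Ioo]

section Density

variable {f : ℝ → ℝ}

instance : NullSingletonClass (dist f) :=
  inferInstanceAs (NullSingletonClass (volume.withDensity _))

namespace IsNonnegDensity

lemma integrable (hf : IsNonnegDensity f) : Integrable f := by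
  by_contra hnot
  exact zero_ne_one ((integral_undef hnot).symm.trans hf.integral_eq_one)

lemma isProbabilityMeasure (hf : IsNonnegDensity f) : IsProbabilityMeasure (dist f) := by
  constructor
  rw [dist, withDensity_apply _ MeasurableSet.univ, Measure.restrict_univ,
    ← ofReal_integral_eq_lintegral_ofReal hf.integrable (ae_of_all _ hf.nonneg),
    hf.integral_eq_one, ENNReal.ofReal_one]

lemma measurableSet_supp (hf : IsNonnegDensity f) : MeasurableSet (supp f) :=
  measurableSet_lt measurable_const hf.measurable

lemma nonneg_of_mem_supp (hf : IsNonnegDensity f) {z : ℝ} (hz : z ∈ supp f) : 0 ≤ z :=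
  le_of_not_gt fun hneg => (hf.eq_zero_of_neg z hneg).not_gt hz

lemma ae_mem_supp (hf : IsNonnegDensity f) : ∀ᵐ z ∂dist f, z ∈ supp f := by
  rw [dist, ae_withDensity_iff hf.measurable.ennreal_ofReal]
  exact ae_of_all _ fun z hz => by simpa [supp] using hz

lemma ae_nonneg (hf : IsNonnegDensity f) : ∀ᵐ z ∂dist f, 0 ≤ z :=
  hf.ae_mem_supp.mono fun _ => hf.nonneg_of_mem_supp

lemma cdf_eq_measureReal_Iic (hf : IsNonnegDensity f) (z : ℝ) :
    cdf f z = (dist f).real (Iic z) := by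
  rw [cdf, measureReal_def, dist, withDensity_apply _ measurableSet_Iic,
    integral_eq_lintegral_of_nonneg_ae (ae_of_all _ hf.nonneg) hf.measurable.aestronglyMeasurable]

lemma cdf_eq_measureReal_Iio (hf : IsNonnegDensity f) (z : ℝ) :
    cdf f z = (dist f).real (Iio z) := by
  rw [hf.cdf_eq_measureReal_Iic, measureReal_congr Iio_ae_eq_Iic]

lemma one_sub_cdf_eq_measureReal_Ioi (hf : IsNonnegDensity f) (z : ℝ) :
    1 - cdf f z = (dist f).real (Ioi z) := by
  have := hf.isProbabilityMeasure
  rw [hf.cdf_eq_measureReal_Iic, ← probReal_compl_eq_one_sub measurableSet_Iic, compl_Iic]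

lemma cdf_nonneg (hf : IsNonnegDensity f) (z : ℝ) : 0 ≤ cdf f z := by
  rw [hf.cdf_eq_measureReal_Iic]; exact measureReal_nonneg

lemma one_sub_cdf_nonneg (hf : IsNonnegDensity f) (z : ℝ) : 0 ≤ 1 - cdf f z := by
  rw [hf.one_sub_cdf_eq_measureReal_Ioi]; exact measureReal_nonneg

lemma monotone_cdf (hf : IsNonnegDensity f) : Monotone (cdf f) := by
  have := hf.isProbabilityMeasure
  intro a b hab
  rw [hf.cdf_eq_measureReal_Iic, hf.cdf_eq_measureReal_Iic]
  exact measureReal_mono (Iic_subset_Iic.2 hab)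

lemma measurable_survivalRatio (hf : IsNonnegDensity f) :
    Measurable fun u => (1 - cdf f u) / f u :=
  (measurable_const.sub hf.monotone_cdf.measurable).div hf.measurable

lemma survivalRatio_nonneg (hf : IsNonnegDensity f) (u : ℝ) : 0 ≤ (1 - cdf f u) / f u :=
  div_nonneg (hf.one_sub_cdf_nonneg u) (hf.nonneg u)

lemma measurable_virtualValue (hf : IsNonnegDensity f) : Measurable (virtualValue f) :=
  measurable_id.sub hf.measurable_survivalRatio

lemma measurable_virtualCost (hf : IsNonnegDensity f) : Measurable (virtualCost f) :=
  measurable_id.add (hf.monotone_cdf.measurable.div hf.measurable)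

lemma virtualValue_le_self (hf : IsNonnegDensity f) (v : ℝ) : virtualValue f v ≤ v :=
  sub_le_self _ (hf.survivalRatio_nonneg v)

lemma self_le_virtualCost (hf : IsNonnegDensity f) (c : ℝ) : c ≤ virtualCost f c :=
  le_add_of_nonneg_right (div_nonneg (hf.cdf_nonneg c) (hf.nonneg c))

lemma integrable_self (hf : IsNonnegDensity f) (hmean : Integrable fun z => z * f z) :
    Integrable (fun z => z) (dist f) := by
  rw [dist, integrable_withDensity_iff hf.measurable.ennreal_ofReal (by simp)]
  simpa only [ENNReal.toReal_ofReal (hf.nonneg _)] using hmean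

lemma lintegral_ofReal_div_mul (hf : IsNonnegDensity f) {a : ℝ → ℝ} (ha : Measurable a)
    {h : ℝ → ENNReal} (hh : Measurable h) :
    ∫⁻ u, ENNReal.ofReal (a u / f u) * h u ∂dist f =
      ∫⁻ u in supp f, ENNReal.ofReal (a u) * h u := by
  rw [← lintegral_indicator hf.measurableSet_supp]
  refine (lintegral_withDensity_eq_lintegral_mul _ hf.measurable.ennreal_ofReal
    ((ha.div hf.measurable).ennreal_ofReal.mul hh)).trans (lintegral_congr fun u => ?_)
  by_cases hu : u ∈ supp f
  · simp only [indicator_of_mem hu, Pi.mul_apply, Pi.div_apply]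
    rw [← mul_assoc, ← ENNReal.ofReal_mul (hf.nonneg u),
      mul_div_cancel₀ _ (ne_of_gt hu)]
  · have hfu : f u = 0 := le_antisymm (not_lt.1 hu) (hf.nonneg u)
    simp [hu, hfu]

lemma lintegral_measureReal_div_mul (hf : IsNonnegDensity f) {R : Set (ℝ × ℝ)}
    (hR : MeasurableSet R) {h : ℝ → ENNReal} (hh : Measurable h) :
    ∫⁻ u, ENNReal.ofReal ((dist f).real {v | (u, v) ∈ R} / f u) * h u ∂dist f =
      ∫⁻ v, (∫⁻ u in {u | (u, v) ∈ R} ∩ supp f, h u) ∂dist f := by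
  have := hf.isProbabilityMeasure
  have hsection : Measurable fun u => (dist f).real {v | (u, v) ∈ R} :=
    (measurable_measure_prodMk_left hR).ennreal_toReal
  rw [hf.lintegral_ofReal_div_mul hsection hh]
  have hreal : ∀ u, ENNReal.ofReal ((dist f).real {v | (u, v) ∈ R}) = dist f {v | (u, v) ∈ R} :=
    fun u => ofReal_measureReal
  simp only [hreal]
  rw [lintegral_measure_prodMk_left_mul hR hh]
  refine lintegral_congr fun v => ?_
  rw [Measure.restrict_restrict (s := {u | (u, v) ∈ R}) (measurable_prodMk_right hR)]

lemma lintegral_survivalRatio_mul (hf : IsNonnegDensity f) {h : ℝ → ENNReal} (hh : Measurable h) :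
    ∫⁻ u, ENNReal.ofReal ((1 - cdf f u) / f u) * h u ∂dist f =
      ∫⁻ v, (∫⁻ u in Iio v ∩ supp f, h u) ∂dist f := by
  simp only [hf.one_sub_cdf_eq_measureReal_Ioi]
  exact hf.lintegral_measureReal_div_mul (R := {q | q.1 < q.2})
    (measurableSet_lt measurable_fst measurable_snd) hh

lemma lintegral_cdf_div_mul (hf : IsNonnegDensity f) {h : ℝ → ENNReal} (hh : Measurable h) :
    ∫⁻ u, ENNReal.ofReal (cdf f u / f u) * h u ∂dist f =
      ∫⁻ v, (∫⁻ u in Ioi v ∩ supp f, h u) ∂dist f := by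
  simp only [hf.cdf_eq_measureReal_Iio]
  exact hf.lintegral_measureReal_div_mul (R := {q | q.2 < q.1})
    (measurableSet_lt measurable_snd measurable_fst) hh

lemma setLIntegral_survivalRatio (hf : IsNonnegDensity f) {S : Set ℝ} (hS : MeasurableSet S) :
    ∫⁻ u in S, ENNReal.ofReal ((1 - cdf f u) / f u) ∂dist f =
      ∫⁻ v, volume (S ∩ (Iio v ∩ supp f)) ∂dist f :=
  calc ∫⁻ u in S, ENNReal.ofReal ((1 - cdf f u) / f u) ∂dist f
      = ∫⁻ u, ENNReal.ofReal ((1 - cdf f u) / f u) * S.indicator 1 u ∂dist f := by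
        rw [← lintegral_indicator hS]
        exact lintegral_congr fun u => by by_cases hu : u ∈ S <;> simp [hu]
    _ = ∫⁻ v, volume (S ∩ (Iio v ∩ supp f)) ∂dist f := by
        rw [hf.lintegral_survivalRatio_mul (measurable_one.indicator hS)]
        exact lintegral_congr fun v => by
          rw [lintegral_indicator_one hS, Measure.restrict_apply hS]

lemma lintegral_volume_inter_Iio_supp_lt_top (hf : IsNonnegDensity f)
    (hmean : Integrable fun z => z * f z) (S : Set ℝ) :
    ∫⁻ v, volume (S ∩ (Iio v ∩ supp f)) ∂dist f < ⊤ := by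
  refine lt_of_le_of_lt (lintegral_mono fun v => ?_)
    ((hasFiniteIntegral_iff_ofReal hf.ae_nonneg).1 (hf.integrable_self hmean).2)
  calc volume (S ∩ (Iio v ∩ supp f))
      ≤ volume (Ico 0 v) := measure_mono fun u hu => ⟨hf.nonneg_of_mem_supp hu.2.2, hu.2.1⟩
    _ = ENNReal.ofReal v := by rw [Real.volume_Ico, sub_zero]

lemma integrable_survivalRatio (hf : IsNonnegDensity f) (hmean : Integrable fun z => z * f z) :
    Integrable (fun u => (1 - cdf f u) / f u) (dist f) := by
  refine ⟨hf.measurable_survivalRatio.aestronglyMeasurable, ?_⟩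
  rw [hasFiniteIntegral_iff_ofReal (ae_of_all _ hf.survivalRatio_nonneg), ← setLIntegral_univ,
    hf.setLIntegral_survivalRatio MeasurableSet.univ]
  exact hf.lintegral_volume_inter_Iio_supp_lt_top hmean univ

lemma integrable_virtualValue (hf : IsNonnegDensity f) (hmean : Integrable fun z => z * f z) :
    Integrable (virtualValue f) (dist f) :=
  (hf.integrable_self hmean).sub (hf.integrable_survivalRatio hmean)

/-! ### Myerson's lemma -/

lemma setIntegral_virtualValue_sub (hf : IsNonnegDensity f) (hmean : Integrable fun z => z * f z)
    {S : Set ℝ} (hS : MeasurableSet S) {p : ℝ} (hp : S ⊆ Ici p) :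
    ∫ v in S, (virtualValue f v - p) ∂dist f =
      (∫⁻ v in S, volume (Ioo p v) ∂dist f).toReal -
        (∫⁻ v, volume (S ∩ (Iio v ∩ supp f)) ∂dist f).toReal := by
  have := hf.isProbabilityMeasure
  have hratio := hf.integrable_survivalRatio hmean
  have hmargin : Integrable (fun v => v - p) (dist f) :=
    (hf.integrable_self hmean).sub (integrable_const p)
  have hsplit : ∀ v, virtualValue f v - p = (v - p) - (1 - cdf f v) / f v := fun v =>
    sub_right_comm _ _ _
  simp only [hsplit]
  rw [integral_sub hmargin.integrableOn hratio.integrableOn,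
    setIntegral_sub_eq_toReal_lintegral hS hp,
    integral_eq_lintegral_of_nonneg_ae (ae_of_all _ hf.survivalRatio_nonneg) hratio.1.restrict,
    hf.setLIntegral_survivalRatio hS]

lemma setIntegral_virtualValue_sub_nonneg (hf : IsNonnegDensity f)
    (hmean : Integrable fun z => z * f z) {S : Set ℝ} (hS : MeasurableSet S)
    (hup : IsUpperSet S) {p : ℝ} (hp : S ⊆ Ici p) :
    0 ≤ ∫ v in S, (virtualValue f v - p) ∂dist f := by
  have := hf.isProbabilityMeasure
  rw [hf.setIntegral_virtualValue_sub hmean hS hp, sub_nonneg]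
  refine ENNReal.toReal_mono ?_ ?_
  · simp only [Real.volume_Ioo]
    exact ((hf.integrable_self hmean).sub (integrable_const p)).integrableOn.lintegral_lt_top.ne
  · rw [← lintegral_indicator hS]
    refine lintegral_mono fun v => ?_
    by_cases hv : v ∈ S
    · rw [indicator_of_mem hv, Ioo_ae_eq_Ico.measure_eq]
      exact measure_mono fun u hu => ⟨hp hu.1, hu.2.1⟩
    · have hempty : S ∩ (Iio v ∩ supp f) = ∅ :=
        eq_empty_of_forall_notMem fun u hu => hv (hup hu.2.1.le hu.1)
      simp [hempty]

lemma setIntegral_Ici_virtualValue_sub_nonpos (hf : IsNonnegDensity f)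
    (hmean : Integrable fun z => z * f z) {p : ℝ} (hp : ∀ v ∈ supp f, Ioo p v ⊆ supp f) :
    ∫ v in Ici p, (virtualValue f v - p) ∂dist f ≤ 0 := by
  rw [hf.setIntegral_virtualValue_sub hmean measurableSet_Ici subset_rfl, sub_nonpos]
  refine ENNReal.toReal_mono (hf.lintegral_volume_inter_Iio_supp_lt_top hmean _).ne ?_
  refine (setLIntegral_le_lintegral _ _).trans
    (lintegral_mono_ae (hf.ae_mem_supp.mono fun v hv => ?_))
  exact measure_mono fun u hu => ⟨hu.1.le, hu.2, hp v hv hu⟩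

end IsNonnegDensity

end Density

/-! ### The inverse of the virtual value -/

section Inverse

variable {f : ℝ → ℝ} {s v : ℝ}

lemma virtualValueInv_le (hv : v ∈ supp f) (hsv : s ≤ virtualValue f v) :
    virtualValueInv f s ≤ v :=
  sInf_le ⟨v, ⟨hv, hsv⟩, rfl⟩

lemma le_virtualValueInv (hreg : StrictMonoOn (virtualValue f) (supp f)) (hv : v ∈ supp f)
    (hvs : virtualValue f v < s) : (v : EReal) ≤ virtualValueInv f s := by
  refine le_sInf ?_
  rintro _ ⟨w, ⟨hw, hsw⟩, rfl⟩
  exact EReal.coe_le_coe_iff.2 ((hreg.lt_iff_lt hv hw).1 (hvs.trans_le hsw)).le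

lemma monotone_virtualValueInv : Monotone (virtualValueInv f) := fun _ _ hab =>
  sInf_le_sInf (image_mono fun _ hv => ⟨hv.1, hab.trans hv.2⟩)

namespace IsNonnegDensity

lemma self_le_virtualValueInv (hf : IsNonnegDensity f) (s : ℝ) :
    (s : EReal) ≤ virtualValueInv f s := by
  refine le_sInf ?_
  rintro _ ⟨w, ⟨_, hsw⟩, rfl⟩
  exact EReal.coe_le_coe_iff.2 (hsw.trans (hf.virtualValue_le_self w))

lemma virtualValueInv_ne_bot (hf : IsNonnegDensity f) (s : ℝ) : virtualValueInv f s ≠ ⊥ :=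
  ne_bot_of_le_ne_bot (EReal.coe_ne_bot s) (hf.self_le_virtualValueInv s)

lemma virtualValueInv_nonneg (hf : IsNonnegDensity f) (s : ℝ) : 0 ≤ virtualValueInv f s := by
  refine le_sInf ?_
  rintro _ ⟨w, ⟨hw, _⟩, rfl⟩
  exact EReal.coe_nonneg.2 (hf.nonneg_of_mem_supp hw)

lemma Ioo_subset_supp_of_virtualValueInv_eq (hf : IsNonnegDensity f) {p : ℝ}
    (hp : virtualValueInv f s = p) (hv : v ∈ supp f) : Ioo p v ⊆ supp f := by
  intro u hu
  obtain ⟨_, ⟨w, ⟨hw, _⟩, rfl⟩, hwu⟩ : ∃ x ∈ _, x < (u : EReal) :=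
    sInf_lt_iff.1 (hp.trans_lt (EReal.coe_lt_coe_iff.2 hu.1))
  exact hf.ordConnected.out hw hv ⟨(EReal.coe_lt_coe_iff.1 hwu).le, hu.2.le⟩

lemma nullSingletonClass_map_virtualValue (hf : IsNonnegDensity f)
    (hreg : StrictMonoOn (virtualValue f) (supp f)) :
    NullSingletonClass ((dist f).map (virtualValue f)) := by
  refine ⟨fun s => ?_⟩
  have hsub : (supp f ∩ virtualValue f ⁻¹' {s}).Subsingleton := fun a ha b hb =>
    hreg.injOn ha.1 hb.1 (ha.2.trans hb.2.symm)
  rw [Measure.map_apply hf.measurable_virtualValue (measurableSet_singleton s)]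
  refine measure_mono_null_ae ?_ (hsub.measure_zero (dist f))
  filter_upwards [hf.ae_mem_supp] with v hv hvs using ⟨hv, hvs⟩

lemma cdf_map_virtualValue (hf : IsNonnegDensity f) (s : ℝ) :
    ProbabilityTheory.cdf ((dist f).map (virtualValue f)) s =
      (dist f).real {v | virtualValue f v ≤ s} := by
  have := hf.isProbabilityMeasure
  have := Measure.isProbabilityMeasure_map (μ := dist f) hf.measurable_virtualValue.aemeasurable
  rw [ProbabilityTheory.cdf_eq_real,
    map_measureReal_apply hf.measurable_virtualValue measurableSet_Iic]
  rfl

lemma ae_lt_virtualValueInv_iff (hf : IsNonnegDensity f)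
    (hreg : StrictMonoOn (virtualValue f) (supp f)) (s : ℝ) :
    ∀ᵐ v : ℝ ∂dist f, (v : EReal) < virtualValueInv f s ↔ virtualValue f v ≤ s := by
  have hvalue : ∀ᵐ v ∂dist f, virtualValue f v ≠ s := by
    have := hf.nullSingletonClass_map_virtualValue hreg
    exact ae_of_ae_map hf.measurable_virtualValue.aemeasurable (Measure.ae_ne _ s)
  have hprice : ∀ᵐ v : ℝ ∂dist f, (v : EReal) ≠ virtualValueInv f s := by
    have hsub : {v : ℝ | (v : EReal) = virtualValueInv f s}.Subsingleton := fun a ha b hb =>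
      EReal.coe_injective (Eq.trans ha (Eq.symm hb))
    simpa only [ae_iff, not_not] using hsub.measure_zero (dist f)
  filter_upwards [hf.ae_mem_supp, hvalue, hprice] with v hv hvs hvp
  refine ⟨fun hlt => ?_, fun hle => (le_virtualValueInv hreg hv (hle.lt_of_ne hvs)).lt_of_ne hvp⟩
  by_contra! hgt
  exact (virtualValueInv_le hv hgt.le).not_gt hlt

lemma measureReal_lt_virtualValueInv (hf : IsNonnegDensity f)
    (hreg : StrictMonoOn (virtualValue f) (supp f)) (s : ℝ) :
    (dist f).real {v : ℝ | (v : EReal) < virtualValueInv f s} =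
      ProbabilityTheory.cdf ((dist f).map (virtualValue f)) s := by
  rw [hf.cdf_map_virtualValue]
  exact measureReal_congr ((hf.ae_lt_virtualValueInv_iff hreg s).mono fun _ hv => propext hv)

lemma integrable_max_virtualValue_sub (hf : IsNonnegDensity f)
    (hmean : Integrable fun z => z * f z) (s : ℝ) :
    Integrable (fun v => max 0 (virtualValue f v - s)) (dist f) := by
  have := hf.isProbabilityMeasure
  exact (integrable_const 0).sup ((hf.integrable_virtualValue hmean).sub (integrable_const s))

lemma integral_max_virtualValue_sub (hf : IsNonnegDensity f)
    (hreg : StrictMonoOn (virtualValue f) (supp f)) (s : ℝ) :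
    ∫ v, max 0 (virtualValue f v - s) ∂dist f =
      ∫ v in {v : ℝ | virtualValueInv f s ≤ v}, (virtualValue f v - s) ∂dist f := by
  rw [← integral_indicator (measurableSet_le measurable_const measurable_coe_real_ereal)]
  refine integral_congr_ae ?_
  filter_upwards [hf.ae_lt_virtualValueInv_iff hreg s] with v hv
  by_cases hvs : virtualValue f v ≤ s
  · rw [max_eq_left (sub_nonpos.2 hvs), indicator_of_notMem]
    exact not_le.2 (hv.2 hvs)
  · rw [max_eq_right (sub_nonneg.2 (not_le.1 hvs).le), indicator_of_mem]
    exact not_lt.1 fun hlt => hvs (hv.1 hlt)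

lemma integral_max_virtualValue_sub_le (hf : IsNonnegDensity f)
    (hmean : Integrable fun z => z * f z) (hreg : StrictMonoOn (virtualValue f) (supp f))
    (s : ℝ) :
    ∫ v, max 0 (virtualValue f v - s) ∂dist f ≤
      (dist f).real {v : ℝ | virtualValueInv f s ≤ v} * ((virtualValueInv f s).toReal - s) := by
  have := hf.isProbabilityMeasure
  rw [hf.integral_max_virtualValue_sub hreg]
  induction hprice : virtualValueInv f s using EReal.rec with
  | bot => exact absurd hprice (hf.virtualValueInv_ne_bot s)
  | top => simp
  | coe p =>
    have hset : {v : ℝ | (p : EReal) ≤ v} = Ici p := by ext v; simp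
    have hmyerson := hf.setIntegral_Ici_virtualValue_sub_nonpos hmean
      fun v hv => hf.Ioo_subset_supp_of_virtualValueInv_eq hprice hv
    have hvirtual := (hf.integrable_virtualValue hmean).integrableOn (s := Ici p)
    have hconst (a : ℝ) : IntegrableOn (fun _ => a) (Ici p) (dist f) := integrable_const a
    rw [integral_sub hvirtual (hconst p), setIntegral_const, smul_eq_mul] at hmyerson
    rw [hset, integral_sub hvirtual (hconst s), setIntegral_const, smul_eq_mul, EReal.toReal_coe]
    linarith

end IsNonnegDensity

end Inverse

/-! ### The reserve -/

lemma continuous_cdf (μ : Measure ℝ) [IsProbabilityMeasure μ] [NullSingletonClass μ] :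
    Continuous (ProbabilityTheory.cdf μ) := by
  refine continuous_iff_continuousAt.2 fun s => ?_
  have hjump := (ProbabilityTheory.cdf μ).measure_singleton s
  rw [ProbabilityTheory.measure_cdf, measure_singleton] at hjump
  rw [(ProbabilityTheory.cdf μ).mono.continuousAt_iff_leftLim_eq_rightLim,
    (ProbabilityTheory.cdf μ).rightLim_eq]
  exact le_antisymm ((ProbabilityTheory.cdf μ).mono.leftLim_le le_rfl)
    (sub_nonpos.1 (ENNReal.ofReal_eq_zero.1 hjump.symm))

section Reserve

variable {n : ℕ} {f : Fin n → ℝ → ℝ} {θ θ' : Fin n → ℝ}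

/-- The probability that no item has a virtual value exceeding its cost by more than `t`: the
distribution function, at `t ≥ 0`, of the maximum whose median is the virtual reserve. -/
noncomputable def noSaleProb (f : Fin n → ℝ → ℝ) (θ : Fin n → ℝ) (t : ℝ) : ℝ :=
  ∏ i, ProbabilityTheory.cdf ((dist (f i)).map (virtualValue (f i))) (t + θ i)

lemma noSaleProb_le_noSaleProb {t t' : ℝ} (hle : ∀ i, t + θ i ≤ t' + θ' i) :
    noSaleProb f θ t ≤ noSaleProb f θ' t' :=
  Finset.prod_le_prod (fun _ _ => ProbabilityTheory.cdf_nonneg _ _)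
    fun i _ => ProbabilityTheory.monotone_cdf _ (hle i)

lemma continuous_noSaleProb (hf : ∀ i, IsNonnegDensity (f i))
    (hreg : ∀ i, StrictMonoOn (virtualValue (f i)) (supp (f i))) (θ : Fin n → ℝ) :
    Continuous (noSaleProb f θ) := by
  refine continuous_finsetProd _ fun i _ => ?_
  have := (hf i).isProbabilityMeasure
  have := Measure.isProbabilityMeasure_map (μ := dist (f i))
    (hf i).measurable_virtualValue.aemeasurable
  have := (hf i).nullSingletonClass_map_virtualValue (hreg i)
  exact (continuous_cdf _).comp (continuous_add_const (θ i))

lemma tendsto_noSaleProb_atTop (f : Fin n → ℝ → ℝ) (θ : Fin n → ℝ) :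
    Tendsto (noSaleProb f θ) atTop (𝓝 1) := by
  have hfactor := fun i => (ProbabilityTheory.tendsto_cdf_atTop
    ((dist (f i)).map (virtualValue (f i)))).comp
      (tendsto_atTop_add_const_right atTop (θ i) tendsto_id)
  have hprod := tendsto_finsetProd Finset.univ fun i _ => hfactor i
  rwa [Finset.prod_const_one] at hprod

instance [∀ i, IsProbabilityMeasure (dist (f i))] : IsProbabilityMeasure (jointDist f) :=
  inferInstanceAs (IsProbabilityMeasure (Measure.pi _))

lemma jointDist_real_pi [∀ i, IsProbabilityMeasure (dist (f i))] (s : Fin n → Set ℝ) :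
    (jointDist f).real (univ.pi s) = ∏ i, (dist (f i)).real (s i) := by
  simp only [measureReal_def, jointDist, Measure.pi_pi, ENNReal.toReal_prod]

lemma half_le_measureReal_iSup_iff (hf : ∀ i, IsNonnegDensity (f i)) (θ : Fin n → ℝ) (t : ℝ) :
    1 / 2 ≤ (jointDist f).real {v | (⨆ i, max 0 (virtualValue (f i) (v i) - θ i)) ≤ t} ↔
      0 ≤ t ∧ 1 / 2 ≤ noSaleProb f θ t := by
  have := fun i => (hf i).isProbabilityMeasure
  rcases lt_or_ge t 0 with ht | ht
  · have hempty : {v : Fin n → ℝ | (⨆ i, max 0 (virtualValue (f i) (v i) - θ i)) ≤ t} = ∅ :=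
      eq_empty_of_forall_notMem fun v hv =>
        ht.not_ge ((Real.iSup_nonneg fun i => le_max_left _ _).trans hv)
    rw [hempty, measureReal_empty]
    exact iff_of_false (by norm_num) fun h => ht.not_ge h.1
  · have hpi : {v : Fin n → ℝ | (⨆ i, max 0 (virtualValue (f i) (v i) - θ i)) ≤ t} =
        univ.pi fun i => {x | virtualValue (f i) x ≤ t + θ i} := by
      ext v
      simp only [mem_ofPred_eq, Set.mem_pi, mem_univ, forall_const]
      refine ⟨fun hsup i => ?_, fun hall => Real.iSup_le (fun i => max_le ht ?_) ht⟩
      · exact sub_le_iff_le_add.1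
          ((le_max_right _ _).trans ((le_ciSup (finite_range _).bddAbove i).trans hsup))
      · exact sub_le_iff_le_add.2 (hall i)
    rw [hpi, jointDist_real_pi, noSaleProb]
    simp only [(hf _).cdf_map_virtualValue, ht, true_and]

lemma isLeast_virtualReserve (hf : ∀ i, IsNonnegDensity (f i))
    (hreg : ∀ i, StrictMonoOn (virtualValue (f i)) (supp (f i))) (θ : Fin n → ℝ) :
    IsLeast {t | 0 ≤ t ∧ 1 / 2 ≤ noSaleProb f θ t} (virtualReserve f θ) := by
  have hreserve : virtualReserve f θ = sInf {t | 0 ≤ t ∧ 1 / 2 ≤ noSaleProb f θ t} := by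
    simp only [virtualReserve, half_le_measureReal_iSup_iff hf]
  have hclosed : IsClosed {t | 0 ≤ t ∧ 1 / 2 ≤ noSaleProb f θ t} :=
    isClosed_Ici.inter (isClosed_le continuous_const (continuous_noSaleProb hf hreg θ))
  have hnonempty : {t | 0 ≤ t ∧ 1 / 2 ≤ noSaleProb f θ t}.Nonempty :=
    ((eventually_ge_atTop 0).and ((tendsto_noSaleProb_atTop f θ).eventually
      (eventually_ge_nhds (by norm_num)))).exists
  rw [hreserve]
  exact hclosed.isLeast_csInf hnonempty ⟨0, fun _ ht => ht.1⟩

lemma noSaleProb_virtualReserve_le (hf : ∀ i, IsNonnegDensity (f i))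
    (hreg : ∀ i, StrictMonoOn (virtualValue (f i)) (supp (f i)))
    (hpos : 0 < virtualReserve f θ) : noSaleProb f θ (virtualReserve f θ) ≤ 1 / 2 := by
  by_contra! hgt
  have hnear : ∀ᶠ t in 𝓝[<] virtualReserve f θ, 1 / 2 < noSaleProb f θ t :=
    (((continuous_noSaleProb hf hreg θ).tendsto _).mono_left nhdsWithin_le_nhds).eventually
      (eventually_gt_nhds hgt)
  obtain ⟨t, ht, htlt⟩ := (hnear.and (Ioo_mem_nhdsLT hpos)).exists
  exact htlt.2.not_ge ((isLeast_virtualReserve hf hreg θ).2 ⟨htlt.1.le, ht.le⟩)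

lemma virtualReserve_le_add (hf : ∀ i, IsNonnegDensity (f i))
    (hreg : ∀ i, StrictMonoOn (virtualValue (f i)) (supp (f i))) {d : ℝ} (hd : 0 ≤ d)
    (hle : ∀ i, θ' i ≤ θ i + d) : virtualReserve f θ ≤ virtualReserve f θ' + d := by
  obtain ⟨hnonneg, hhalf⟩ := (isLeast_virtualReserve hf hreg θ').1
  exact (isLeast_virtualReserve hf hreg θ).2 ⟨add_nonneg hnonneg hd,
    hhalf.trans (noSaleProb_le_noSaleProb fun i => by linarith [hle i])⟩

lemma antitone_virtualReserve (hf : ∀ i, IsNonnegDensity (f i))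
    (hreg : ∀ i, StrictMonoOn (virtualValue (f i)) (supp (f i))) :
    Antitone (virtualReserve f) := fun θ θ' hle => by
  simpa only [add_zero] using
    virtualReserve_le_add (θ := θ') hf hreg le_rfl fun i => (hle i).trans (add_zero _).ge

lemma virtualReserve_add_le_update (hf : ∀ i, IsNonnegDensity (f i))
    (hreg : ∀ i, StrictMonoOn (virtualValue (f i)) (supp (f i))) {i : Fin n} {t : ℝ}
    (ht : θ i ≤ t) :
    virtualReserve f θ + θ i ≤ virtualReserve f (Function.update θ i t) + t := by
  have hle : ∀ j, Function.update θ i t j ≤ θ j + (t - θ i) := fun j => by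
    rcases eq_or_ne j i with rfl | hj
    · simp
    · simpa only [Function.update_of_ne hj] using le_add_of_nonneg_right (sub_nonneg.2 ht)
  linarith [virtualReserve_le_add hf hreg (sub_nonneg.2 ht) hle]

lemma continuous_virtualReserve (hf : ∀ i, IsNonnegDensity (f i))
    (hreg : ∀ i, StrictMonoOn (virtualValue (f i)) (supp (f i))) :
    Continuous (virtualReserve f) := by
  refine (LipschitzWith.of_le_add fun θ θ' => ?_).continuous
  refine virtualReserve_le_add hf hreg dist_nonneg fun i => ?_
  have hcoord := dist_le_pi_dist θ θ' i
  rw [Real.dist_eq] at hcoord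
  linarith [neg_abs_le (θ i - θ' i)]

end Reserve

/-! ### The buyer -/

section Buyer

variable {n : ℕ} {p p' : Fin n → EReal} {v : Fin n → ℝ} {i j : Fin n}

lemma coe_sub_nonneg_iff {x : ℝ} {q : EReal} : 0 ≤ (x : EReal) - q ↔ q ≤ x :=
  EReal.sub_nonneg (Or.inl (EReal.coe_ne_top x)) (Or.inl (EReal.coe_ne_bot x))

namespace Buys

lemma price_le (hbuy : Buys p v i) : p i ≤ v i := coe_sub_nonneg_iff.1 hbuy.1

lemma price_ne_top (hbuy : Buys p v i) : p i ≠ ⊤ :=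
  ne_top_of_le_ne_top (EReal.coe_ne_top _) hbuy.price_le

lemma unique (hi : Buys p v i) (hj : Buys p v j) : i = j := by
  rcases lt_trichotomy i j with hlt | heq | hgt
  · exact absurd (hi.2.1 j) (hj.2.2 i hlt).not_ge
  · exact heq
  · exact absurd (hj.2.1 i) (hi.2.2 j hgt).not_ge

lemma mono_price (hown : p i ≤ p' i) (hother : ∀ j ≠ i, p' j ≤ p j) (hbuy : Buys p' v i) :
    Buys p v i := by
  have hown' : (v i : EReal) - p' i ≤ (v i : EReal) - p i := EReal.sub_le_sub le_rfl hown
  have hother' : ∀ j ≠ i, (v j : EReal) - p j ≤ (v j : EReal) - p' j := fun j hj =>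
    EReal.sub_le_sub le_rfl (hother j hj)
  refine ⟨hbuy.1.trans hown', fun j => ?_, fun j hj => ?_⟩
  · rcases eq_or_ne j i with rfl | hj
    · exact le_rfl
    · exact (hother' j hj).trans ((hbuy.2.1 j).trans hown')
  · exact ((hother' j hj.ne).trans_lt (hbuy.2.2 j hj)).trans_le hown'

lemma mono_value {a b : ℝ} (hab : a ≤ b) (hbuy : Buys p (Function.update v i a) i) :
    Buys p (Function.update v i b) i := by
  have hown : (a : EReal) - p i ≤ (b : EReal) - p i :=
    EReal.sub_le_sub (EReal.coe_le_coe_iff.2 hab) le_rfl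
  obtain ⟨hsurplus, hmax, hfirst⟩ := hbuy
  simp only [Buys, Function.update_self] at hsurplus hmax hfirst ⊢
  refine ⟨hsurplus.trans hown, fun j => ?_, fun j hj => ?_⟩
  · rcases eq_or_ne j i with rfl | hj
    · rw [Function.update_self]
    · have hle := hmax j
      rw [Function.update_of_ne hj] at hle ⊢
      exact hle.trans hown
  · have hlt := hfirst j hj
    rw [Function.update_of_ne hj.ne] at hlt ⊢
    exact hlt.trans_le hown

end Buys

lemma exists_buys (hle : p i ≤ v i) : ∃ j, Buys p v j := by
  let best : Set (Fin n) := {k | ∀ j, (v j : EReal) - p j ≤ (v k : EReal) - p k}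
  have : Nonempty (Fin n) := ⟨i⟩
  obtain ⟨k, hk, hfirst⟩ := wellFounded_lt.has_min best
    (Finite.exists_max fun j => (v j : EReal) - p j)
  refine ⟨k, (coe_sub_nonneg_iff.2 hle).trans (hk i), hk, fun j hj => ?_⟩
  by_contra! hge
  exact hfirst j (fun l => (hk l).trans hge) hj

lemma buys_of_forall_lt (hle : p i ≤ v i) (hlt : ∀ j ≠ i, (v j : EReal) < p j) :
    Buys p v i := by
  obtain ⟨k, hk⟩ := exists_buys hle
  rcases eq_or_ne k i with rfl | hki
  · exact hk
  · exact absurd hk.price_le (hlt k hki).not_ge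

lemma measurableSet_buys (i : Fin n) :
    MeasurableSet {q : (Fin n → EReal) × (Fin n → ℝ) | Buys q.1 q.2 i} := by
  have hsurplus : ∀ j, Measurable fun q : (Fin n → EReal) × (Fin n → ℝ) =>
      (q.2 j : EReal) - q.1 j := fun j =>
    (measurable_coe_real_ereal.comp ((measurable_pi_apply j).comp measurable_snd)).sub
      ((measurable_pi_apply j).comp measurable_fst)
  refine (measurableSet_le measurable_const (hsurplus i)).inter (.inter ?_ ?_)
  · exact .congr (.iInter fun j => measurableSet_le (hsurplus j) (hsurplus i))
      (by ext; simp only [mem_iInter]; rfl)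
  · exact .congr (.iInter fun j => .iInter fun _ : j < i =>
      measurableSet_lt (hsurplus j) (hsurplus i)) (by ext; simp only [mem_iInter]; rfl)

lemma measurableSet_buys_right (p : Fin n → EReal) (i : Fin n) :
    MeasurableSet {v | Buys p v i} :=
  measurable_prodMk_left (measurableSet_buys i)

end Buyer

/-! ### Resampling a coordinate -/

section Resampling

variable {ι : Type*} [Fintype ι] [DecidableEq ι] {α : ι → Type*} [∀ i, MeasurableSpace (α i)]
  (μ : ∀ i, Measure (α i)) [∀ i, IsProbabilityMeasure (μ i)] (i : ι)

lemma measurePreserving_update :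
    MeasurePreserving (fun q : (∀ j, α j) × α i => Function.update q.1 i q.2)
      ((Measure.pi μ).prod (μ i)) (Measure.pi μ) := by
  refine ⟨measurable_update', (Measure.pi_eq fun s hs => ?_).symm⟩
  have hpreimage : (fun q : (∀ j, α j) × α i => Function.update q.1 i q.2) ⁻¹' univ.pi s =
      univ.pi (Function.update s i univ) ×ˢ s i := by
    ext q
    simp only [mem_preimage, Set.mem_pi, mem_univ, forall_const, mem_prod]
    rw [Function.forall_update_iff q.1 fun j x => x ∈ s j,
      Function.forall_update_iff s fun j t => q.1 j ∈ t]
    simp [and_comm]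
  rw [Measure.map_apply measurable_update' (MeasurableSet.univ_pi hs), hpreimage,
    Measure.prod_prod, Measure.pi_pi, ← Finset.mul_prod_erase _ _ (Finset.mem_univ i),
    ← Finset.mul_prod_erase _ (fun j => μ j (s j)) (Finset.mem_univ i), Function.update_self,
    measure_univ, one_mul, mul_comm]
  congr 1
  exact Finset.prod_congr rfl fun j hj => by
    rw [Function.update_of_ne (Finset.ne_of_mem_erase hj)]

lemma integral_pi_eq_integral_update {E : Type*} [NormedAddCommGroup E] [NormedSpace ℝ E]
    {F : (∀ j, α j) → E} (hF : Integrable F (Measure.pi μ)) :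
    ∫ v, F v ∂Measure.pi μ = ∫ v, (∫ u, F (Function.update v i u) ∂μ i) ∂Measure.pi μ := by
  have hupdate := measurePreserving_update μ i
  rw [← hupdate.hasLaw.integral_comp hF.1]
  exact integral_prod _ (hupdate.integrable_comp_of_integrable hF)

lemma lintegral_pi_eq_lintegral_update {F : (∀ j, α j) → ENNReal} (hF : Measurable F) :
    ∫⁻ v, F v ∂Measure.pi μ = ∫⁻ v, (∫⁻ u, F (Function.update v i u) ∂μ i) ∂Measure.pi μ := by
  rw [← (measurePreserving_update μ i).lintegral_comp hF]
  exact lintegral_prod _ (hF.comp measurable_update').aemeasurable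

end Resampling

/-! ### The algorithmic pricing problem -/

section Pricing

variable {n : ℕ} {f : Fin n → ℝ → ℝ} {p p' : Fin n → EReal} {i : Fin n}

lemma saleProb_nonneg (f : Fin n → ℝ → ℝ) (p : Fin n → EReal) (i : Fin n) :
    0 ≤ saleProb f p i :=
  measureReal_nonneg

lemma saleProb_eq_zero_of_price_eq_top (htop : p i = ⊤) : saleProb f p i = 0 := by
  have hempty : {v | Buys p v i} = ∅ :=
    eq_empty_of_forall_notMem fun _ hbuy => hbuy.price_ne_top htop
  rw [saleProb, hempty, measureReal_empty]

section Probability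

variable [∀ i, IsProbabilityMeasure (dist (f i))]

lemma sum_saleProb (p : Fin n → EReal) :
    ∑ i, saleProb f p i = (jointDist f).real {v | ∃ i, Buys p v i} := by
  rw [← iUnion_ofPred, measureReal_iUnion_fintype
    (fun i j hij => disjoint_left.2 fun v hi hj => hij (hi.unique hj))
    (measurableSet_buys_right p)]
  rfl

lemma sum_saleProb_le_one (p : Fin n → EReal) : ∑ i, saleProb f p i ≤ 1 :=
  (sum_saleProb p).trans_le measureReal_le_one

lemma saleProb_le_saleProb (hown : p i ≤ p' i) (hother : ∀ j ≠ i, p' j ≤ p j) :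
    saleProb f p' i ≤ saleProb f p i :=
  measureReal_mono fun _ hbuy => hbuy.mono_price hown hother

lemma measureReal_mul_prod_le_saleProb (p : Fin n → EReal) (i : Fin n) :
    (dist (f i)).real {v : ℝ | p i ≤ v} *
        ∏ j ∈ Finset.univ \ {i}, (dist (f j)).real {v : ℝ | (v : EReal) < p j} ≤
      saleProb f p i := by
  let s : Fin n → Set ℝ := fun j => {v : ℝ | (v : EReal) < p j}
  have hsub : univ.pi (Function.update s i {v : ℝ | p i ≤ v}) ⊆ {v | Buys p v i} := fun v hv => by
    have hv' := (Function.forall_update_iff s fun j t => v j ∈ t).1 fun j => hv j (mem_univ j)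
    exact buys_of_forall_lt hv'.1 hv'.2
  refine le_of_eq_of_le ?_ (measureReal_mono (μ := jointDist f) hsub)
  rw [jointDist_real_pi]
  simp only [Function.apply_update fun j => (dist (f j)).real]
  rw [Finset.prod_update_of_mem (Finset.mem_univ i)]

end Probability

/-- The profit of selling to a buyer who pays `r` for certain and, for each item separately, the
excess of its virtual value over `r` and its cost: an upper bound, for every `r ≥ 0`, on the profit
of all prices. -/
noncomputable def prophetBound (f : Fin n → ℝ → ℝ) (θ : Fin n → ℝ) (r : ℝ) : ℝ :=
  r + ∑ i, ∫ u, max 0 (virtualValue (f i) u - (r + θ i)) ∂dist (f i)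

lemma pricingProfit_eq_add_sum (f : Fin n → ℝ → ℝ) (θ : Fin n → ℝ) (p : Fin n → EReal) (r : ℝ) :
    pricingProfit f θ p =
      r * ∑ i, saleProb f p i + ∑ i, saleProb f p i * ((p i).toReal - (r + θ i)) := by
  rw [pricingProfit, Finset.mul_sum, ← Finset.sum_add_distrib]
  exact Finset.sum_congr rfl fun i _ => by ring

lemma setIntegral_buys_virtualValue_sub_nonneg (hf : ∀ i, IsNonnegDensity (f i))
    (hmean : ∀ i, Integrable fun z => z * f i z) {a : ℝ} (hp : p i = a) :
    0 ≤ ∫ v in {v | Buys p v i}, (virtualValue (f i) (v i) - a) ∂jointDist f := by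
  have := fun i => (hf i).isProbabilityMeasure
  have hbuys := measurableSet_buys_right p i
  let buyers (v : Fin n → ℝ) : Set ℝ := {u | Buys p (Function.update v i u) i}
  have hbuyers (v : Fin n → ℝ) : MeasurableSet (buyers v) := measurable_update v hbuys
  have hint : Integrable ({v | Buys p v i}.indicator fun v => virtualValue (f i) (v i) - a)
      (jointDist f) := by
    refine Integrable.indicator ?_ hbuys
    exact integrable_comp_eval (μ := fun j => dist (f j)) (i := i)
      (((hf i).integrable_virtualValue (hmean i)).sub (integrable_const a))
  have hresample : ∫ v in {v | Buys p v i}, (virtualValue (f i) (v i) - a) ∂jointDist f =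
      ∫ v, (∫ u in buyers v, (virtualValue (f i) u - a) ∂dist (f i)) ∂jointDist f := by
    rw [← integral_indicator hbuys]
    refine (integral_pi_eq_integral_update _ i hint).trans (integral_congr_ae (ae_of_all _ ?_))
    intro v
    simp only [← integral_indicator (hbuyers v)]
    exact integral_congr_ae (ae_of_all _ fun u => by simp [indicator, buyers])
  rw [hresample]
  refine integral_nonneg fun v => (hf i).setIntegral_virtualValue_sub_nonneg (hmean i)
    (hbuyers v) (fun _ _ hab hbuy => hbuy.mono_value hab) fun u hu => ?_
  have hprice := Buys.price_le hu
  rwa [hp, Function.update_self, EReal.coe_le_coe_iff] at hprice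

lemma saleProb_mul_sub_le (hf : ∀ i, IsNonnegDensity (f i))
    (hmean : ∀ i, Integrable fun z => z * f i z) (hp : p i ≠ ⊥) (s : ℝ) :
    saleProb f p i * ((p i).toReal - s) ≤
      ∫ u, max 0 (virtualValue (f i) u - s) ∂dist (f i) := by
  have := fun i => (hf i).isProbabilityMeasure
  induction hprice : p i using EReal.rec with
  | bot => exact absurd hprice hp
  | top =>
    rw [saleProb_eq_zero_of_price_eq_top hprice, zero_mul]
    exact integral_nonneg fun u => le_max_left _ _
  | coe a =>
    have hvirtual : Integrable (fun v => virtualValue (f i) (v i)) (jointDist f) :=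
      integrable_comp_eval ((hf i).integrable_virtualValue (hmean i))
    have hexcess := (hf i).integrable_max_virtualValue_sub (hmean i) s
    have hexcess' : Integrable (fun v => max 0 (virtualValue (f i) (v i) - s)) (jointDist f) :=
      integrable_comp_eval (μ := fun j => dist (f j)) (i := i) hexcess
    have hconst (b : ℝ) : Integrable (fun _ => b) (jointDist f) := integrable_const b
    have hmyerson := setIntegral_buys_virtualValue_sub_nonneg hf hmean hprice
    rw [integral_sub hvirtual.integrableOn (hconst a).integrableOn, setIntegral_const,
      smul_eq_mul] at hmyerson
    calc saleProb f p i * (a - s)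
        = (jointDist f).real {v | Buys p v i} * a - (jointDist f).real {v | Buys p v i} * s :=
          mul_sub _ _ _
      _ ≤ ∫ v in {v | Buys p v i}, (virtualValue (f i) (v i) - s) ∂jointDist f := by
          rw [integral_sub hvirtual.integrableOn (hconst s).integrableOn, setIntegral_const,
            smul_eq_mul]
          linarith
      _ ≤ ∫ v in {v | Buys p v i}, max 0 (virtualValue (f i) (v i) - s) ∂jointDist f :=
          integral_mono (hvirtual.sub (hconst s)).integrableOn hexcess'.integrableOn
            fun v => le_max_right _ _
      _ ≤ ∫ v, max 0 (virtualValue (f i) (v i) - s) ∂jointDist f :=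
          setIntegral_le_integral hexcess' (ae_of_all _ fun v => le_max_left _ _)
      _ = ∫ u, max 0 (virtualValue (f i) u - s) ∂dist (f i) :=
          integral_comp_eval (μ := fun j => dist (f j)) (i := i) hexcess.1

lemma pricingProfit_le_prophetBound (hf : ∀ i, IsNonnegDensity (f i))
    (hmean : ∀ i, Integrable fun z => z * f i z)
    (θ : Fin n → ℝ) (hp : ∀ i, p i ≠ ⊥) {r : ℝ} (hr : 0 ≤ r) :
    pricingProfit f θ p ≤ prophetBound f θ r := by
  have := fun i => (hf i).isProbabilityMeasure
  rw [pricingProfit_eq_add_sum f θ p r, prophetBound]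
  exact add_le_add (mul_le_of_le_one_right hr (sum_saleProb_le_one p))
    (Finset.sum_le_sum fun i _ => saleProb_mul_sub_le hf hmean (hp i) _)

lemma noSaleProb_virtualReserve (hf : ∀ i, IsNonnegDensity (f i))
    (hreg : ∀ i, StrictMonoOn (virtualValue (f i)) (supp (f i))) (θ : Fin n → ℝ) :
    noSaleProb f θ (virtualReserve f θ) =
      ∏ i, (dist (f i)).real {v : ℝ | (v : EReal) < reservePrices f θ i} :=
  Finset.prod_congr rfl fun i _ => ((hf i).measureReal_lt_virtualValueInv (hreg i) _).symm

lemma half_mul_measureReal_le_saleProb (hf : ∀ i, IsNonnegDensity (f i))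
    (hreg : ∀ i, StrictMonoOn (virtualValue (f i)) (supp (f i))) (θ : Fin n → ℝ) (i : Fin n) :
    1 / 2 * (dist (f i)).real {v : ℝ | reservePrices f θ i ≤ v} ≤
      saleProb f (reservePrices f θ) i := by
  have := fun i => (hf i).isProbabilityMeasure
  refine le_trans ?_ (measureReal_mul_prod_le_saleProb _ i)
  rw [mul_comm]
  refine mul_le_mul_of_nonneg_left ?_ measureReal_nonneg
  have hhalf := (isLeast_virtualReserve hf hreg θ).1.2
  rw [noSaleProb_virtualReserve hf hreg,
    ← Finset.prod_sdiff (Finset.subset_univ {i}), Finset.prod_singleton] at hhalf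
  exact hhalf.trans (mul_le_of_le_one_right (Finset.prod_nonneg fun _ _ => measureReal_nonneg)
    measureReal_le_one)

lemma half_le_sum_saleProb (hf : ∀ i, IsNonnegDensity (f i))
    (hreg : ∀ i, StrictMonoOn (virtualValue (f i)) (supp (f i)))
    (θ : Fin n → ℝ) (hpos : 0 < virtualReserve f θ) :
    1 / 2 ≤ ∑ i, saleProb f (reservePrices f θ) i := by
  have := fun i => (hf i).isProbabilityMeasure
  let unsold : Set (Fin n → ℝ) := univ.pi fun i => {v : ℝ | (v : EReal) < reservePrices f θ i}
  have hunsold : MeasurableSet unsold :=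
    .univ_pi fun i => measurableSet_lt measurable_coe_real_ereal measurable_const
  have hhalf : (jointDist f).real unsold ≤ 1 / 2 := by
    rw [jointDist_real_pi, ← noSaleProb_virtualReserve hf hreg]
    exact noSaleProb_virtualReserve_le hf hreg hpos
  calc 1 / 2 ≤ 1 - (jointDist f).real unsold := by linarith
    _ = (jointDist f).real unsoldᶜ := (probReal_compl_eq_one_sub hunsold).symm
    _ ≤ (jointDist f).real {v | ∃ i, Buys (reservePrices f θ) v i} := by
        refine measureReal_mono fun v hv => ?_
        obtain ⟨i, hi⟩ : ∃ i, reservePrices f θ i ≤ v i := by simpa [unsold] using hv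
        exact exists_buys hi
    _ = ∑ i, saleProb f (reservePrices f θ) i := (sum_saleProb _).symm

lemma half_mul_integral_max_le (hf : ∀ i, IsNonnegDensity (f i))
    (hreg : ∀ i, StrictMonoOn (virtualValue (f i)) (supp (f i)))
    (θ : Fin n → ℝ) (hmean : ∀ i, Integrable fun z => z * f i z) (i : Fin n) :
    1 / 2 * ∫ u, max 0 (virtualValue (f i) u - (virtualReserve f θ + θ i)) ∂dist (f i) ≤
      saleProb f (reservePrices f θ) i *
        ((reservePrices f θ i).toReal - (virtualReserve f θ + θ i)) := by
  have hexcess := (hf i).integral_max_virtualValue_sub_le (hmean i) (hreg i)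
    (virtualReserve f θ + θ i)
  change _ ≤ (dist (f i)).real {v : ℝ | reservePrices f θ i ≤ v} *
    ((reservePrices f θ i).toReal - _) at hexcess
  have hhalf := half_mul_measureReal_le_saleProb hf hreg θ i
  rcases eq_or_ne (reservePrices f θ i) ⊤ with htop | htop
  · rw [saleProb_eq_zero_of_price_eq_top htop, zero_mul]
    simp only [htop, top_le_iff, EReal.coe_ne_top, ofPred_false, measureReal_empty, zero_mul]
      at hexcess
    linarith
  · have hprice : virtualReserve f θ + θ i ≤ (reservePrices f θ i).toReal :=
      EReal.coe_le_coe_iff.1 (((hf i).self_le_virtualValueInv _).trans_eq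
        (EReal.coe_toReal htop ((hf i).virtualValueInv_ne_bot _)).symm)
    linarith [mul_le_mul_of_nonneg_right hhalf (sub_nonneg.2 hprice)]

lemma half_mul_prophetBound_le_pricingProfit (hf : ∀ i, IsNonnegDensity (f i))
    (hreg : ∀ i, StrictMonoOn (virtualValue (f i)) (supp (f i)))
    (θ : Fin n → ℝ) (hmean : ∀ i, Integrable fun z => z * f i z) :
    1 / 2 * prophetBound f θ (virtualReserve f θ) ≤ pricingProfit f θ (reservePrices f θ) := by
  have hsale : 1 / 2 * virtualReserve f θ ≤
      virtualReserve f θ * ∑ i, saleProb f (reservePrices f θ) i := by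
    rcases (isLeast_virtualReserve hf hreg θ).1.1.eq_or_lt with hzero | hpos
    · simp [← hzero]
    · rw [mul_comm]
      exact mul_le_mul_of_nonneg_left (half_le_sum_saleProb hf hreg θ hpos) hpos.le
  rw [pricingProfit_eq_add_sum f θ _ (virtualReserve f θ), prophetBound, mul_add, Finset.mul_sum]
  exact add_le_add hsale
    (Finset.sum_le_sum fun i _ => half_mul_integral_max_le hf hreg θ hmean i)

theorem half_mul_pricingProfit_le (hf : ∀ i, IsNonnegDensity (f i))
    (hreg : ∀ i, StrictMonoOn (virtualValue (f i)) (supp (f i)))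
    (θ : Fin n → ℝ) (hmean : ∀ i, Integrable fun z => z * f i z)
    (hp : ∀ i, p i ≠ ⊥) :
    1 / 2 * pricingProfit f θ p ≤ pricingProfit f θ (reservePrices f θ) :=
  (mul_le_mul_of_nonneg_left (pricingProfit_le_prophetBound hf hmean θ hp
    (isLeast_virtualReserve hf hreg θ).1.1) (by norm_num)).trans
    (half_mul_prophetBound_le_pricingProfit hf hreg θ hmean)

theorem saleProb_reservePrices_update_le (hf : ∀ i, IsNonnegDensity (f i))
    (hreg : ∀ i, StrictMonoOn (virtualValue (f i)) (supp (f i)))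
    (θ : Fin n → ℝ) {t : ℝ} (ht : θ i ≤ t) :
    saleProb f (reservePrices f (Function.update θ i t)) i ≤
      saleProb f (reservePrices f θ) i := by
  have := fun i => (hf i).isProbabilityMeasure
  refine saleProb_le_saleProb (monotone_virtualValueInv ?_) fun j hj =>
    monotone_virtualValueInv ?_
  · rw [Function.update_self]
    exact virtualReserve_add_le_update hf hreg ht
  · rw [Function.update_of_ne hj]
    gcongr
    exact antitone_virtualReserve hf hreg (le_update_iff.2 ⟨ht, fun _ _ => le_rfl⟩)

end Pricing

/-! ### Incentives of a seller -/

/-- Incentive compatibility for a seller whose cost lies in `S`: `U a` is the utility of cost `a`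
under a truthful report and `y b` the probability of sale after the report `b`, so that cost `a`
obtains `U b + y b * (b - a)` by reporting `b`. -/
def IsIncentiveCompatible (S : Set ℝ) (U y : ℝ → ℝ) : Prop :=
  ∀ a ∈ S, ∀ b ∈ S, U b + y b * (b - a) ≤ U a

section Seller

variable {S : Set ℝ} {U y : ℝ → ℝ} {a b : ℝ}

lemma IsIncentiveCompatible.antitoneOn (hic : IsIncentiveCompatible S U y) : AntitoneOn y S := by
  intro a ha b hb hab
  rcases hab.eq_or_lt with rfl | hab
  · exact le_rfl
  · have hprofit : 0 ≤ (y a - y b) * (b - a) := by linarith [hic a ha b hb, hic b hb a ha]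
    exact sub_nonneg.1 (nonneg_of_mul_nonneg_left hprofit (sub_pos.2 hab))

lemma intervalIntegrable_of_antitoneOn_ordConnected (hS : S.OrdConnected) (hy : AntitoneOn y S)
    (ha : a ∈ S) (hb : b ∈ S) : IntervalIntegrable y volume a b :=
  (hy.mono (hS.uIcc_subset ha hb)).intervalIntegrable

lemma IsIncentiveCompatible.intervalIntegral_le_add_div_two_pow
    (hic : IsIncentiveCompatible S U y) (hS : S.OrdConnected) (k : ℕ)
    (ha : a ∈ S) (hb : b ∈ S) (hab : a ≤ b) :
    ∫ u in a..b, y u ≤ U a - U b + (y a - y b) * (b - a) / 2 ^ k := by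
  have hint {s t : ℝ} (hs : s ∈ S) (ht : t ∈ S) : IntervalIntegrable y volume s t :=
    intervalIntegrable_of_antitoneOn_ordConnected hS hic.antitoneOn hs ht
  induction k generalizing a b with
  | zero =>
    have hmono : ∫ u in a..b, y u ≤ ∫ _ in a..b, y a :=
      intervalIntegral.integral_mono_on hab (hint ha hb) intervalIntegrable_const
        fun u hu => hic.antitoneOn ha (hS.out ha hb hu) hu.1
    rw [intervalIntegral.integral_const, smul_eq_mul] at hmono
    rw [pow_zero, div_one]
    linarith [hic a ha b hb]
  | succ k ih =>
    have hleft : a ≤ (a + b) / 2 := by linarith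
    have hright : (a + b) / 2 ≤ b := by linarith
    have hmid : (a + b) / 2 ∈ S := hS.out ha hb ⟨hleft, hright⟩
    calc ∫ u in a..b, y u
        = (∫ u in a..(a + b) / 2, y u) + ∫ u in (a + b) / 2..b, y u :=
          (intervalIntegral.integral_add_adjacent_intervals (hint ha hmid) (hint hmid hb)).symm
      _ ≤ _ := add_le_add (ih ha hmid hleft) (ih hmid hb hright)
      _ = U a - U b + (y a - y b) * (b - a) / 2 ^ (k + 1) := by field_simp; ring

lemma IsIncentiveCompatible.intervalIntegral_le (hic : IsIncentiveCompatible S U y)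
    (hS : S.OrdConnected) (ha : a ∈ S) (hb : b ∈ S) (hab : a ≤ b) :
    ∫ u in a..b, y u ≤ U a - U b := by
  have hlim : Tendsto (fun k : ℕ => U a - U b + (y a - y b) * (b - a) / 2 ^ k) atTop
      (𝓝 (U a - U b + 0)) :=
    tendsto_const_nhds.add (tendsto_const_nhds.div_atTop
      (tendsto_pow_atTop_atTop_of_one_lt one_lt_two))
  rw [add_zero] at hlim
  exact ge_of_tendsto' hlim fun k => hic.intervalIntegral_le_add_div_two_pow hS k ha hb hab

lemma ae_exists_rat_mem_of_ordConnected (hS : S.OrdConnected) :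
    ∀ᵐ u : ℝ, u ∈ S → ∃ q : ℚ, (q : ℝ) ∈ S ∧ u ≤ q := by
  have htop : {u | u ∈ S ∧ ∀ w ∈ S, w ≤ u}.Subsingleton := fun u hu w hw =>
    le_antisymm (hw.2 u hu.1) (hu.2 w hw.1)
  filter_upwards [measure_eq_zero_iff_ae_notMem.1 (htop.measure_zero volume)] with u hmax hu
  obtain ⟨w, hw, huw⟩ : ∃ w ∈ S, u < w := by
    by_contra! hle
    exact hmax ⟨hu, hle⟩
  obtain ⟨q, huq, hqw⟩ := exists_rat_btwn huw
  exact ⟨q, hS.out hu hw ⟨huq.le, hqw.le⟩, huq.le⟩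

lemma IsIncentiveCompatible.lintegral_le (hic : IsIncentiveCompatible S U y)
    (hS : S.OrdConnected) (hU : ∀ a ∈ S, 0 ≤ U a) (hy : ∀ u, 0 ≤ y u) (ha : a ∈ S) :
    ∫⁻ u in S ∩ Ioi a, ENNReal.ofReal (y u) ≤ ENNReal.ofReal (U a) := by
  have hIoc {b : ℝ} (hb : b ∈ S) :
      ∫⁻ u in Ioc a b, ENNReal.ofReal (y u) ≤ ENNReal.ofReal (U a) := by
    rcases lt_or_ge b a with hba | hab
    · rw [Ioc_eq_empty hba.not_gt, Measure.restrict_empty, lintegral_zero_measure]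
      exact zero_le
    have hint := intervalIntegrable_of_antitoneOn_ordConnected hS hic.antitoneOn ha hb
    rw [← ofReal_integral_eq_lintegral_ofReal
      ((intervalIntegrable_iff_integrableOn_Ioc_of_le hab).1 hint) (ae_of_all _ hy),
      ← intervalIntegral.integral_of_le hab]
    exact ENNReal.ofReal_le_ofReal (by linarith [hic.intervalIntegral_le hS ha hb hab, hU b hb])
  have hcover : (S ∩ Ioi a : Set ℝ) ≤ᵐ[volume]
      (⋃ q : {q : ℚ // (q : ℝ) ∈ S}, Ioc a (q : ℝ) : Set ℝ) := by
    filter_upwards [ae_exists_rat_mem_of_ordConnected hS] with u hrat hu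
    obtain ⟨q, hq, huq⟩ := hrat hu.1
    exact mem_iUnion.2 ⟨⟨q, hq⟩, hu.2, huq⟩
  have hdir : Directed (· ⊆ ·) fun q : {q : ℚ // (q : ℝ) ∈ S} => Ioc a (q : ℝ) := by
    refine directed_of_isDirected_le fun q q' hqq' => Ioc_subset_Ioc_right ?_
    exact_mod_cast hqq'
  refine (lintegral_mono' (Measure.restrict_mono_ae hcover) le_rfl).trans ?_
  rw [setLIntegral_iUnion_of_directed _ hdir]
  exact iSup_le fun q => hIoc q.2

lemma setIntegral_inter_Ioi_eq_add (hS : S.OrdConnected) (hint : IntegrableOn y S)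
    (ha : a ∈ S) (hb : b ∈ S) (hab : a ≤ b) :
    ∫ u in S ∩ Ioi a, y u = (∫ u in a..b, y u) + ∫ u in S ∩ Ioi b, y u := by
  have hsub : Ioc a b ⊆ S := Ioc_subset_Icc_self.trans (hS.out ha hb)
  have hunion : S ∩ Ioi a = Ioc a b ∪ S ∩ Ioi b := by
    rw [← Ioc_union_Ioi_eq_Ioi hab, inter_union_distrib_left, inter_eq_right.2 hsub]
  rw [hunion, setIntegral_union (disjoint_left.2 fun u hle hgt => hle.2.not_gt hgt.2)
    (hS.measurableSet.inter measurableSet_Ioi) (hint.mono_set hsub)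
    (hint.mono_set inter_subset_left), intervalIntegral.integral_of_le hab]

lemma isIncentiveCompatible_setIntegral_inter_Ioi (hS : S.OrdConnected) (hy : AntitoneOn y S)
    (hint : IntegrableOn y S) :
    IsIncentiveCompatible S (fun a => ∫ u in S ∩ Ioi a, y u) y := by
  intro a ha b hb
  rcases le_total a b with hab | hba
  · have hmono : ∫ _ in a..b, y b ≤ ∫ u in a..b, y u :=
      intervalIntegral.integral_mono_on hab intervalIntegrable_const
        (intervalIntegrable_of_antitoneOn_ordConnected hS hy ha hb)
        fun u hu => hy (hS.out ha hb hu) hb hu.2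
    rw [intervalIntegral.integral_const, smul_eq_mul] at hmono
    linarith [setIntegral_inter_Ioi_eq_add hS hint ha hb hab]
  · have hmono : ∫ u in b..a, y u ≤ ∫ _ in b..a, y b :=
      intervalIntegral.integral_mono_on hba
        (intervalIntegrable_of_antitoneOn_ordConnected hS hy hb ha) intervalIntegrable_const
        fun u hu => hy hb (hS.out hb ha hu) hu.1
    rw [intervalIntegral.integral_const, smul_eq_mul] at hmono
    linarith [setIntegral_inter_Ioi_eq_add hS hint hb ha hba]

end Seller

/-! ### Virtual costs -/

section Cost

lemma IsNonnegDensity.cdf_comp_neg {g : ℝ → ℝ} (hg : IsNonnegDensity g) (z : ℝ) :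
    cdf (fun t => g (-t)) z = 1 - cdf g (-z) := by
  have hreflect : cdf (fun t => g (-t)) z = ∫ t in Ioi (-z), g t := integral_comp_neg_Iic z g
  have htotal := intervalIntegral.integral_Iic_add_Ioi (b := -z) hg.integrable.integrableOn
    hg.integrable.integrableOn
  rw [hg.integral_eq_one] at htotal
  rw [hreflect, cdf]
  linarith

lemma IsNonnegDensity.monotoneOn_virtualCost {g : ℝ → ℝ} (hg : IsNonnegDensity g)
    (hMHR : HasMHR fun z => g (-z)) : MonotoneOn (virtualCost g) (supp g) := by
  intro a ha b hb hab
  refine add_le_add hab ?_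
  rcases (hg.cdf_nonneg a).eq_or_lt with hzero | hpos
  · rw [← hzero, zero_div]
    exact div_nonneg (hg.cdf_nonneg b) (hg.nonneg b)
  · have hpos' : 0 < cdf g b := hpos.trans_le (hg.monotone_cdf hab)
    have hratio : g b / cdf g b ≤ g a / cdf g a := by
      simpa [hazardRate, hg.cdf_comp_neg] using hMHR (a := -b) (b := -a)
        (by simpa [hg.cdf_comp_neg] using hpos') (by simpa [hg.cdf_comp_neg] using hpos)
        (neg_le_neg hab)
    rw [div_le_div_iff₀ hpos' hpos] at hratio
    rw [div_le_div_iff₀ ha hb]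
    linarith

variable {n : ℕ} {g : Fin n → ℝ → ℝ} {x : (Fin n → ℝ) → ℝ}

/-- The profile of virtual costs of the cost profile `c`. -/
noncomputable def virtualCosts (g : Fin n → ℝ → ℝ) (c : Fin n → ℝ) : Fin n → ℝ :=
  fun i => virtualCost (g i) (c i)

/-- The information rent of seller `i` at costs `c` under the allocation `x`: the least utility
that incentive compatibility leaves to him. It takes values in `[0, ∞]`, so that no integrability
has to be assumed of `x`. -/
noncomputable def rent (g : Fin n → ℝ → ℝ) (x : (Fin n → ℝ) → ℝ) (i : Fin n) (c : Fin n → ℝ) :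
    ENNReal :=
  ∫⁻ u in supp (g i) ∩ Ioi (c i), ENNReal.ofReal (x (Function.update c i u))

lemma virtualCosts_update (g : Fin n → ℝ → ℝ) (c : Fin n → ℝ) (i : Fin n) (u : ℝ) :
    virtualCosts g (Function.update c i u) =
      Function.update (virtualCosts g c) i (virtualCost (g i) u) :=
  funext fun j => Function.apply_update (fun j => virtualCost (g j)) c i u j

lemma measurable_virtualCosts (hg : ∀ i, IsNonnegDensity (g i)) : Measurable (virtualCosts g) :=
  measurable_pi_iff.2 fun i => (hg i).measurable_virtualCost.comp (measurable_pi_apply i)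

lemma ae_forall_mem_supp (hg : ∀ i, IsNonnegDensity (g i)) :
    ∀ᵐ c ∂jointDist g, ∀ i, c i ∈ supp (g i) := by
  have := fun i => (hg i).isProbabilityMeasure
  exact ae_all_iff.2 fun i =>
    (measurePreserving_eval (fun j => dist (g j)) i).quasiMeasurePreserving.ae (hg i).ae_mem_supp

lemma ae_mul_virtualCosts_nonneg (hg : ∀ i, IsNonnegDensity (g i)) (hx : ∀ c, 0 ≤ x c)
    (i : Fin n) : 0 ≤ᵐ[jointDist g] fun c => x c * virtualCosts g c i :=
  (ae_forall_mem_supp hg).mono fun c hc => mul_nonneg (hx c)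
    (((hg i).nonneg_of_mem_supp (hc i)).trans ((hg i).self_le_virtualCost _))

lemma measurable_rent {i : Fin n} (hg : IsNonnegDensity (g i)) (hx : Measurable x) :
    Measurable (rent g x i) := by
  let R : Set ((Fin n → ℝ) × ℝ) := {q | q.2 ∈ supp (g i) ∩ Ioi (q.1 i)}
  have hR : MeasurableSet R := (hg.measurableSet_supp.preimage measurable_snd).inter
    (measurableSet_lt ((measurable_pi_apply i).comp measurable_fst) measurable_snd)
  have hrent : rent g x i = fun c => ∫⁻ u,
      R.indicator (fun q => ENNReal.ofReal (x (Function.update q.1 i q.2))) (c, u) := by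
    funext c
    rw [rent, ← lintegral_indicator (hg.measurableSet_supp.inter measurableSet_Ioi)]
    rfl
  rw [hrent]
  exact ((hx.comp measurable_update').ennreal_ofReal.indicator hR).lintegral_prod_right'

lemma lintegral_rent (hg : ∀ i, IsNonnegDensity (g i)) (hx : Measurable x) (i : Fin n) :
    ∫⁻ c, rent g x i c ∂jointDist g =
      ∫⁻ c, ENNReal.ofReal (cdf (g i) (c i) / g i (c i)) * ENNReal.ofReal (x c)
        ∂jointDist g := by
  have := fun i => (hg i).isProbabilityMeasure
  have hmarkup : Measurable fun c : Fin n → ℝ =>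
      ENNReal.ofReal (cdf (g i) (c i) / g i (c i)) * ENNReal.ofReal (x c) :=
    (((hg i).monotone_cdf.measurable.div (hg i).measurable).comp
      (measurable_pi_apply i)).ennreal_ofReal.mul hx.ennreal_ofReal
  rw [jointDist, lintegral_pi_eq_lintegral_update _ i (measurable_rent (hg i) hx),
    lintegral_pi_eq_lintegral_update _ i hmarkup]
  refine lintegral_congr fun c => ?_
  simp only [rent, Function.update_self, Function.update_idem, inter_comm (supp (g i))]
  exact ((hg i).lintegral_cdf_div_mul (hx.comp (measurable_update c)).ennreal_ofReal).symm

lemma lintegral_cost_add_rent (hg : ∀ i, IsNonnegDensity (g i)) (hx : Measurable x)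
    (hx0 : ∀ c, 0 ≤ x c) (i : Fin n) :
    ∫⁻ c, (ENNReal.ofReal (x c * c i) + rent g x i c) ∂jointDist g =
      ∫⁻ c, ENNReal.ofReal (x c * virtualCosts g c i) ∂jointDist g := by
  have hmeas : Measurable fun c : Fin n → ℝ => ENNReal.ofReal (x c * c i) :=
    (hx.mul (measurable_pi_apply i)).ennreal_ofReal
  rw [lintegral_add_right _ (measurable_rent (hg i) hx), lintegral_rent hg hx,
    ← lintegral_add_left hmeas]
  refine lintegral_congr_ae ((ae_forall_mem_supp hg).mono fun c hc => ?_)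
  have hmarkup : 0 ≤ cdf (g i) (c i) / g i (c i) :=
    div_nonneg ((hg i).cdf_nonneg _) ((hg i).nonneg _)
  have hcost : 0 ≤ c i := (hg i).nonneg_of_mem_supp (hc i)
  simp only [virtualCosts, virtualCost, mul_add]
  rw [ENNReal.ofReal_add (mul_nonneg (hx0 c) hcost) (mul_nonneg (hx0 c) hmarkup),
    mul_comm (x c) (_ / _), ENNReal.ofReal_mul hmarkup]

end Cost

/-! ### Conditioning on seed and costs -/

section Conditioning

variable {α β γ : Type*} [MeasurableSpace α] [MeasurableSpace β] [MeasurableSpace γ]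
  {μ : Measure α} {ν : Measure β} {ρ : Measure γ} [SFinite μ] [SFinite ν] [SFinite ρ]

lemma measurePreserving_prod_middle :
    MeasurePreserving (fun q : (α × γ) × β => (q.1.1, q.2, q.1.2)) ((μ.prod ρ).prod ν)
      (μ.prod (ν.prod ρ)) :=
  ((MeasurePreserving.id μ).prod Measure.measurePreserving_swap).comp
    (measurePreserving_prodAssoc μ ρ ν)

lemma integrable_integral_prod_middle {F : α × β × γ → ℝ}
    (hF : Integrable F (μ.prod (ν.prod ρ))) :
    Integrable (fun s : α × γ => ∫ v, F (s.1, v, s.2) ∂ν) (μ.prod ρ) :=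
  (measurePreserving_prod_middle.integrable_comp_of_integrable hF).integral_prod_left

lemma integral_prod_middle {F : α × β × γ → ℝ} (hF : Integrable F (μ.prod (ν.prod ρ))) :
    ∫ q, F q ∂μ.prod (ν.prod ρ) =
      ∫ s : α × γ, (∫ v, F (s.1, v, s.2) ∂ν) ∂μ.prod ρ := by
  rw [← measurePreserving_prod_middle.hasLaw.integral_comp hF.1]
  exact integral_prod _ (measurePreserving_prod_middle.integrable_comp_of_integrable hF)

lemma integrable_mul_comp_snd {h : α × β → ℝ} {w : β → ℝ} (hh : Measurable h) (hw : Measurable w)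
    (hnonneg : ∀ s, 0 ≤ h s) (hsection : ∀ b, Integrable (fun a => h (a, b)) μ)
    (hint : Integrable (fun b => (∫ a, h (a, b) ∂μ) * w b) ν) :
    Integrable (fun s => h s * w s.2) (μ.prod ν) := by
  have hmeas : Measurable fun s : α × β => h s * w s.2 := hh.mul (hw.comp measurable_snd)
  rw [integrable_prod_iff' hmeas.aestronglyMeasurable]
  refine ⟨ae_of_all _ fun b => (hsection b).mul_const (w b),
    hint.norm.congr (ae_of_all _ fun b => ?_)⟩
  simp only [norm_mul, integral_mul_const, Real.norm_of_nonneg (hnonneg _),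
    Real.norm_of_nonneg (integral_nonneg fun a => hnonneg (a, b))]

end Conditioning

/-! ### Revenue of a protocol -/

section Protocols

variable {n : ℕ} {f g : Fin n → ℝ → ℝ} {M : Protocol n}

/-- The joint law of seed and costs, that is, of all that the prices of a protocol depend on. -/
noncomputable abbrev reportDist (g : Fin n → ℝ → ℝ) : Measure (unitInterval × (Fin n → ℝ)) :=
  (volume : Measure unitInterval).prod (jointDist g)

open Classical in
/-- The price paid by the buyer at seed, values and costs `q`: the revenue of the intermediary
before the transfers to the sellers. -/
noncomputable def Protocol.buyerPayment (M : Protocol n)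
    (q : unitInterval × (Fin n → ℝ) × (Fin n → ℝ)) : ℝ :=
  ∑ i, if Buys (M.price q.1 q.2.2) q.2.1 i then (M.price q.1 q.2.2 i).toReal else 0

lemma Protocol.profit_eq (M : Protocol n) (q : unitInterval × (Fin n → ℝ) × (Fin n → ℝ)) :
    M.profit q = M.buyerPayment q - ∑ i, M.pay q.2.2 i :=
  rfl

lemma Protocol.measurable_buyerPayment
    (hprice : Measurable fun q : unitInterval × (Fin n → ℝ) => M.price q.1 q.2) :
    Measurable M.buyerPayment := by
  classical
  have hposted : Measurable fun q : unitInterval × (Fin n → ℝ) × (Fin n → ℝ) =>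
      M.price q.1 q.2.2 :=
    hprice.comp (measurable_fst.prodMk (measurable_snd.comp measurable_snd))
  refine Finset.measurable_fun_sum _ fun i _ => Measurable.ite ?_
    ((measurable_pi_apply i).comp hposted).ereal_toReal measurable_const
  exact (hposted.prodMk (measurable_fst.comp measurable_snd)) (measurableSet_buys i)

lemma Protocol.buyerPayment_le (hbot : ∀ ω c i, M.price ω c i ≠ ⊥)
    (q : unitInterval × (Fin n → ℝ) × (Fin n → ℝ)) : M.buyerPayment q ≤ ∑ i, |q.2.1 i| := by
  refine Finset.sum_le_sum fun i _ => ?_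
  split_ifs with hbuy
  · exact (EReal.toReal_le_toReal hbuy.price_le (hbot _ _ _) (EReal.coe_ne_top _)).trans
      (le_abs_self _)
  · exact abs_nonneg _

lemma Protocol.buyerPayment_nonneg (hnonneg : ∀ ω c i, 0 ≤ M.price ω c i)
    (q : unitInterval × (Fin n → ℝ) × (Fin n → ℝ)) : 0 ≤ M.buyerPayment q := by
  refine Finset.sum_nonneg fun i _ => ?_
  split_ifs
  · exact EReal.toReal_nonneg (hnonneg _ _ i)
  · exact le_rfl

lemma Protocol.alloc_nonneg (M : Protocol n) (f : Fin n → ℝ → ℝ) (c : Fin n → ℝ) (i : Fin n) :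
    0 ≤ M.alloc f c i :=
  measureReal_nonneg

lemma pricingProfit_eq_sub (f : Fin n → ℝ → ℝ) (θ : Fin n → ℝ) (p : Fin n → EReal) :
    pricingProfit f θ p = pricingProfit f 0 p - ∑ i, saleProb f p i * θ i := by
  simp only [pricingProfit, Pi.zero_apply, sub_zero, mul_sub, Finset.sum_sub_distrib]

variable [∀ i, IsProbabilityMeasure (dist (f i))]

lemma measurable_saleProb (i : Fin n) : Measurable fun p : Fin n → EReal => saleProb f p i :=
  (measurable_measure_prodMk_left (measurableSet_buys i)).ennreal_toReal

lemma Protocol.alloc_eq_integral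
    (hprice : Measurable fun q : unitInterval × (Fin n → ℝ) => M.price q.1 q.2) (c : Fin n → ℝ)
    (i : Fin n) : M.alloc f c i = ∫ ω, saleProb f (M.price ω c) i := by
  have hbuys : MeasurableSet {q : unitInterval × (Fin n → ℝ) | Buys (M.price q.1 c) q.2 i} :=
    (((hprice.comp measurable_prodMk_right).comp measurable_fst).prodMk measurable_snd)
      (measurableSet_buys i)
  rw [Protocol.alloc, measureReal_def, Measure.prod_apply hbuys]
  exact (integral_toReal (measurable_measure_prodMk_left hbuys).aemeasurable
    (ae_of_all _ fun ω => measure_lt_top _ _)).symm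

lemma Protocol.measurable_alloc
    (hprice : Measurable fun q : unitInterval × (Fin n → ℝ) => M.price q.1 q.2) (i : Fin n) :
    Measurable fun c => M.alloc f c i := by
  have hsale : StronglyMeasurable fun q : unitInterval × (Fin n → ℝ) =>
      saleProb f (M.price q.1 q.2) i := ((measurable_saleProb i).comp hprice).stronglyMeasurable
  simp only [Protocol.alloc_eq_integral hprice]
  exact hsale.integral_prod_left'.measurable

lemma Protocol.integral_buyerPayment (M : Protocol n) (s : unitInterval × (Fin n → ℝ)) :
    ∫ v, M.buyerPayment (s.1, v, s.2) ∂jointDist f = pricingProfit f 0 (M.price s.1 s.2) := by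
  classical
  let sale (i : Fin n) (v : Fin n → ℝ) : ℝ :=
    {v | Buys (M.price s.1 s.2) v i}.indicator (fun _ => (M.price s.1 s.2 i).toReal) v
  have hpayment (v : Fin n → ℝ) : M.buyerPayment (s.1, v, s.2) = ∑ i, sale i v := by
    simp only [Protocol.buyerPayment, sale, indicator_apply, mem_ofPred_eq]
  have hsale (i : Fin n) : Integrable (sale i) (jointDist f) :=
    (integrable_const _).indicator (measurableSet_buys_right _ i)
  simp only [hpayment, integral_finsetSum _ fun i _ => hsale i, pricingProfit, Pi.zero_apply,
    sub_zero, sale, integral_indicator_const _ (measurableSet_buys_right _ _), smul_eq_mul]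
  rfl

lemma Protocol.integrable_saleProb_mul {w : (Fin n → ℝ) → Fin n → ℝ}
    (hprice : Measurable fun q : unitInterval × (Fin n → ℝ) => M.price q.1 q.2)
    (hw : Measurable w) {i : Fin n} [∀ i, IsProbabilityMeasure (dist (g i))]
    (hint : Integrable (fun c => M.alloc f c i * w c i) (jointDist g)) :
    Integrable (fun s : unitInterval × (Fin n → ℝ) =>
      saleProb f (M.price s.1 s.2) i * w s.2 i) (reportDist g) := by
  have hsale : Measurable fun s : unitInterval × (Fin n → ℝ) => saleProb f (M.price s.1 s.2) i :=
    (measurable_saleProb i).comp hprice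
  refine integrable_mul_comp_snd (w := fun c => w c i) hsale ((measurable_pi_apply i).comp hw)
    (fun s => saleProb_nonneg f _ i) (fun c => ?_) ?_
  · exact .of_bound (hsale.comp measurable_prodMk_right).aestronglyMeasurable 1
      (ae_of_all _ fun ω => (Real.norm_of_nonneg (saleProb_nonneg f _ i)).trans_le
        measureReal_le_one)
  · simpa only [Protocol.alloc_eq_integral hprice] using hint

variable [∀ i, IsProbabilityMeasure (dist (g i))]

lemma measurePreserving_outcomeDist_costs :
    MeasurePreserving (fun q : unitInterval × (Fin n → ℝ) × (Fin n → ℝ) => q.2.2)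
      (outcomeDist f g) (jointDist g) :=
  measurePreserving_snd.comp measurePreserving_snd

lemma measurePreserving_outcomeDist_values :
    MeasurePreserving (fun q : unitInterval × (Fin n → ℝ) × (Fin n → ℝ) => q.2.1)
      (outcomeDist f g) (jointDist f) :=
  measurePreserving_fst.comp measurePreserving_snd

lemma integrable_sum_abs_values (hint : ∀ i, Integrable (fun z => z) (dist (f i))) :
    Integrable (fun q : unitInterval × (Fin n → ℝ) × (Fin n → ℝ) => ∑ i, |q.2.1 i|)
      (outcomeDist f g) :=
  integrable_finsetSum _ fun i _ =>
    measurePreserving_outcomeDist_values.integrable_comp_of_integrable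
      (integrable_comp_eval (μ := fun j => dist (f j)) (i := i) (hint i).abs)

section Revenue

variable {w : (Fin n → ℝ) → Fin n → ℝ}

lemma Protocol.integrable_pricingProfit
    (hprice : Measurable fun q : unitInterval × (Fin n → ℝ) => M.price q.1 q.2)
    (hw : Measurable w) (hbuyer : Integrable M.buyerPayment (outcomeDist f g))
    (hcost : ∀ i, Integrable (fun c => M.alloc f c i * w c i) (jointDist g)) :
    Integrable (fun s : unitInterval × (Fin n → ℝ) =>
      pricingProfit f (w s.2) (M.price s.1 s.2)) (reportDist g) := by
  simp only [pricingProfit_eq_sub f (w _), ← Protocol.integral_buyerPayment]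
  exact (integrable_integral_prod_middle hbuyer).sub
    (integrable_finsetSum _ fun i _ => Protocol.integrable_saleProb_mul hprice hw (hcost i))

lemma Protocol.integral_pricingProfit
    (hprice : Measurable fun q : unitInterval × (Fin n → ℝ) => M.price q.1 q.2)
    (hw : Measurable w) (hbuyer : Integrable M.buyerPayment (outcomeDist f g))
    (hcost : ∀ i, Integrable (fun c => M.alloc f c i * w c i) (jointDist g)) :
    ∫ s, pricingProfit f (w s.2) (M.price s.1 s.2) ∂reportDist g =
      ∫ q, M.buyerPayment q ∂outcomeDist f g -
        ∑ i, ∫ c, M.alloc f c i * w c i ∂jointDist g := by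
  have hsale (i : Fin n) := Protocol.integrable_saleProb_mul hprice hw (hcost i)
  have hcosts (i : Fin n) : ∫ s, saleProb f (M.price s.1 s.2) i * w s.2 i ∂reportDist g =
      ∫ c, M.alloc f c i * w c i ∂jointDist g := by
    simp only [integral_prod_symm _ (hsale i), integral_mul_const,
      Protocol.alloc_eq_integral hprice]
  simp only [pricingProfit_eq_sub f (w _), ← Protocol.integral_buyerPayment]
  rw [integral_sub (integrable_integral_prod_middle hbuyer)
    (integrable_finsetSum _ fun i _ => hsale i), integral_finsetSum _ fun i _ => hsale i,
    ← integral_prod_middle hbuyer]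
  simp only [hcosts]
  rfl

lemma Protocol.revenue_eq
    (hprice : Measurable fun q : unitInterval × (Fin n → ℝ) => M.price q.1 q.2)
    (hw : Measurable w) (hbuyer : Integrable M.buyerPayment (outcomeDist f g))
    (hpay : ∀ i, Integrable (fun c => M.pay c i) (jointDist g))
    (hcost : ∀ i, Integrable (fun c => M.alloc f c i * w c i) (jointDist g)) :
    M.revenue f g = ∫ s, pricingProfit f (w s.2) (M.price s.1 s.2) ∂reportDist g +
      ∑ i, (∫ c, M.alloc f c i * w c i ∂jointDist g - ∫ c, M.pay c i ∂jointDist g) := by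
  have hcosts := measurePreserving_outcomeDist_costs (f := f) (g := g)
  have hpay' (i : Fin n) : Integrable (fun q : unitInterval × (Fin n → ℝ) × (Fin n → ℝ) =>
      M.pay q.2.2 i) (outcomeDist f g) := hcosts.integrable_comp_of_integrable (hpay i)
  have hpays (i : Fin n) : ∫ q, M.pay q.2.2 i ∂outcomeDist f g = ∫ c, M.pay c i ∂jointDist g :=
    hcosts.hasLaw.integral_comp (hpay i).1
  have hrevenue : M.revenue f g =
      ∫ q, M.buyerPayment q ∂outcomeDist f g - ∑ i, ∫ c, M.pay c i ∂jointDist g := by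
    simp only [Protocol.revenue, Protocol.profit_eq, ← hpays]
    rw [integral_sub hbuyer (integrable_finsetSum _ fun i _ => hpay' i)]
    exact congrArg _ (integral_finsetSum _ fun i _ => hpay' i)
  rw [hrevenue, Protocol.integral_pricingProfit hprice hw hbuyer hcost, Finset.sum_sub_distrib]
  ring

end Revenue

end Protocols

/-! ### Truthful protocols -/

section Truthful

lemma integrable_of_lintegral_ofReal_le {α : Type*} [MeasurableSpace α] {μ : Measure α}
    {φ ψ : α → ℝ} (hφ : AEStronglyMeasurable φ μ) (hφ0 : 0 ≤ᵐ[μ] φ) (hψ : Integrable ψ μ)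
    (hle : ∫⁻ a, ENNReal.ofReal (φ a) ∂μ ≤ ∫⁻ a, ENNReal.ofReal (ψ a) ∂μ) : Integrable φ μ :=
  ⟨hφ, (hasFiniteIntegral_iff_ofReal hφ0).2 (hle.trans_lt hψ.lintegral_lt_top)⟩

lemma integral_le_integral_of_lintegral_ofReal_le {α : Type*} [MeasurableSpace α] {μ : Measure α}
    {φ ψ : α → ℝ} (hφ : AEStronglyMeasurable φ μ) (hφ0 : 0 ≤ᵐ[μ] φ) (hψ : Integrable ψ μ)
    (hψ0 : 0 ≤ᵐ[μ] ψ)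
    (hle : ∫⁻ a, ENNReal.ofReal (φ a) ∂μ ≤ ∫⁻ a, ENNReal.ofReal (ψ a) ∂μ) :
    ∫ a, φ a ∂μ ≤ ∫ a, ψ a ∂μ := by
  rw [integral_eq_lintegral_of_nonneg_ae hφ0 hφ, integral_eq_lintegral_of_nonneg_ae hψ0 hψ.1]
  exact ENNReal.toReal_mono hψ.lintegral_lt_top.ne hle

variable {n : ℕ} {f g : Fin n → ℝ → ℝ} {M : Protocol n} {c : Fin n → ℝ}

lemma forall_update_mem_supp (hc : ∀ j, c j ∈ supp (g j)) {i : Fin n} {a : ℝ}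
    (ha : a ∈ supp (g i)) : ∀ j, Function.update c i a j ∈ supp (g j) :=
  (Function.forall_update_iff c fun j z => z ∈ supp (g j)).2 ⟨ha, fun j _ => hc j⟩

namespace Protocol.IsTruthful

lemma pay_nonneg (hM : M.IsTruthful f g) (hg : ∀ i, IsNonnegDensity (g i))
    (hc : ∀ j, c j ∈ supp (g j)) (i : Fin n) : 0 ≤ M.pay c i :=
  (mul_nonneg (M.alloc_nonneg f c i) ((hg i).nonneg_of_mem_supp (hc i))).trans
    (sub_nonneg.1 (hM.participation c hc i))

lemma isIncentiveCompatible (hM : M.IsTruthful f g) (hc : ∀ j, c j ∈ supp (g j)) (i : Fin n) :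
    IsIncentiveCompatible (supp (g i))
      (fun a => M.sellerUtility f i a (Function.update c i a))
      (fun a => M.alloc f (Function.update c i a) i) := by
  intro a ha b hb
  have hdom := hM.dominant _ (forall_update_mem_supp hc ha) i b hb
  simp only [Function.update_self, Function.update_idem, Protocol.sellerUtility] at hdom ⊢
  linarith

lemma cost_add_rent_le (hM : M.IsTruthful f g) (hg : ∀ i, IsNonnegDensity (g i))
    (hc : ∀ j, c j ∈ supp (g j)) (i : Fin n) :
    ENNReal.ofReal (M.alloc f c i * c i) + rent g (fun c => M.alloc f c i) i c ≤
      ENNReal.ofReal (M.pay c i) := by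
  have hrent : rent g (fun c => M.alloc f c i) i c ≤
      ENNReal.ofReal (M.pay c i - M.alloc f c i * c i) := by
    have hle := (hM.isIncentiveCompatible hc i).lintegral_le (hg i).ordConnected
      (fun a ha => by
        simpa only [Function.update_self] using
          hM.participation _ (forall_update_mem_supp hc ha) i)
      (fun a => M.alloc_nonneg f _ i) (hc i)
    rwa [Function.update_eq_self] at hle
  have hcost : 0 ≤ M.alloc f c i * c i :=
    mul_nonneg (M.alloc_nonneg f c i) ((hg i).nonneg_of_mem_supp (hc i))
  have hpay : M.alloc f c i * c i ≤ M.pay c i := sub_nonneg.1 (hM.participation c hc i)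
  calc ENNReal.ofReal (M.alloc f c i * c i) + rent g (fun c => M.alloc f c i) i c
      ≤ ENNReal.ofReal (M.alloc f c i * c i) +
          ENNReal.ofReal (M.pay c i - M.alloc f c i * c i) := by gcongr
    _ = ENNReal.ofReal (M.pay c i) := by
        rw [← ENNReal.ofReal_add hcost (sub_nonneg.2 hpay), add_sub_cancel]

variable [∀ i, IsProbabilityMeasure (dist (f i))]

lemma aestronglyMeasurable_alloc_mul_virtualCosts (hM : M.IsTruthful f g)
    (hg : ∀ i, IsNonnegDensity (g i)) (i : Fin n) :
    AEStronglyMeasurable (fun c => M.alloc f c i * virtualCosts g c i) (jointDist g) :=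
  ((Protocol.measurable_alloc hM.measurable_price i).mul
    ((measurable_pi_apply i).comp (measurable_virtualCosts hg))).aestronglyMeasurable

lemma lintegral_alloc_mul_virtualCosts_le (hM : M.IsTruthful f g) (hg : ∀ i, IsNonnegDensity (g i))
    (i : Fin n) :
    ∫⁻ c, ENNReal.ofReal (M.alloc f c i * virtualCosts g c i) ∂jointDist g ≤
      ∫⁻ c, ENNReal.ofReal (M.pay c i) ∂jointDist g := by
  rw [← lintegral_cost_add_rent hg (Protocol.measurable_alloc hM.measurable_price i)
    (fun c => M.alloc_nonneg f c i) i]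
  exact lintegral_mono_ae ((ae_forall_mem_supp hg).mono fun c hc => hM.cost_add_rent_le hg hc i)

variable [∀ i, IsProbabilityMeasure (dist (g i))]

lemma integrable_pay (hM : M.IsTruthful f g) (hg : ∀ i, IsNonnegDensity (g i))
    (hint : ∀ i, Integrable (fun z => z) (dist (f i))) (i : Fin n) :
    Integrable (fun c => M.pay c i) (jointDist g) := by
  have hcosts := measurePreserving_outcomeDist_costs (f := f) (g := g)
  have hmeas : Measurable fun c => M.pay c i := (measurable_pi_apply i).comp hM.measurable_pay
  rw [← hcosts.integrable_comp hmeas.aestronglyMeasurable]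
  refine ((integrable_sum_abs_values hint).sub hM.integrable_profit).mono'
    (hmeas.comp hcosts.measurable).aestronglyMeasurable ?_
  filter_upwards [hcosts.quasiMeasurePreserving.ae (ae_forall_mem_supp hg)] with q hq
  have hsingle : M.pay q.2.2 i ≤ ∑ j, M.pay q.2.2 j :=
    Finset.single_le_sum (fun j _ => hM.pay_nonneg hg hq j) (Finset.mem_univ i)
  simp only [Function.comp_apply, Pi.sub_apply, Protocol.profit_eq]
  rw [Real.norm_of_nonneg (hM.pay_nonneg hg hq i)]
  linarith [Protocol.buyerPayment_le hM.price_ne_bot q]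

lemma integrable_buyerPayment (hM : M.IsTruthful f g) (hg : ∀ i, IsNonnegDensity (g i))
    (hint : ∀ i, Integrable (fun z => z) (dist (f i))) :
    Integrable M.buyerPayment (outcomeDist f g) := by
  have hpay : Integrable (fun q : unitInterval × (Fin n → ℝ) × (Fin n → ℝ) =>
      ∑ i, M.pay q.2.2 i) (outcomeDist f g) := integrable_finsetSum _ fun i _ =>
    measurePreserving_outcomeDist_costs.integrable_comp_of_integrable
      (hM.integrable_pay hg hint i)
  exact (hM.integrable_profit.add hpay).congr
    (ae_of_all _ fun q => sub_add_cancel (M.buyerPayment q) _)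

lemma integrable_alloc_mul_virtualCosts (hM : M.IsTruthful f g)
    (hg : ∀ i, IsNonnegDensity (g i)) (hint : ∀ i, Integrable (fun z => z) (dist (f i)))
    (i : Fin n) : Integrable (fun c => M.alloc f c i * virtualCosts g c i) (jointDist g) :=
  integrable_of_lintegral_ofReal_le (hM.aestronglyMeasurable_alloc_mul_virtualCosts hg i)
    (ae_mul_virtualCosts_nonneg hg (fun c => M.alloc_nonneg f c i) i)
    (hM.integrable_pay hg hint i) (hM.lintegral_alloc_mul_virtualCosts_le hg i)

lemma integral_alloc_mul_virtualCosts_le (hM : M.IsTruthful f g)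
    (hg : ∀ i, IsNonnegDensity (g i)) (hint : ∀ i, Integrable (fun z => z) (dist (f i)))
    (i : Fin n) :
    ∫ c, M.alloc f c i * virtualCosts g c i ∂jointDist g ≤ ∫ c, M.pay c i ∂jointDist g :=
  integral_le_integral_of_lintegral_ofReal_le
    (hM.aestronglyMeasurable_alloc_mul_virtualCosts hg i)
    (ae_mul_virtualCosts_nonneg hg (fun c => M.alloc_nonneg f c i) i)
    (hM.integrable_pay hg hint i)
    ((ae_forall_mem_supp hg).mono fun _ hc => hM.pay_nonneg hg hc i)
    (hM.lintegral_alloc_mul_virtualCosts_le hg i)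

lemma revenue_eq (hM : M.IsTruthful f g) (hg : ∀ i, IsNonnegDensity (g i))
    (hint : ∀ i, Integrable (fun z => z) (dist (f i))) :
    M.revenue f g =
      ∫ s, pricingProfit f (virtualCosts g s.2) (M.price s.1 s.2) ∂reportDist g +
        ∑ i, (∫ c, M.alloc f c i * virtualCosts g c i ∂jointDist g -
          ∫ c, M.pay c i ∂jointDist g) :=
  Protocol.revenue_eq hM.measurable_price (measurable_virtualCosts hg)
    (hM.integrable_buyerPayment hg hint) (hM.integrable_pay hg hint)
    (hM.integrable_alloc_mul_virtualCosts hg hint)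

lemma integrable_pricingProfit (hM : M.IsTruthful f g) (hg : ∀ i, IsNonnegDensity (g i))
    (hint : ∀ i, Integrable (fun z => z) (dist (f i))) :
    Integrable (fun s : unitInterval × (Fin n → ℝ) =>
      pricingProfit f (virtualCosts g s.2) (M.price s.1 s.2)) (reportDist g) :=
  Protocol.integrable_pricingProfit hM.measurable_price (measurable_virtualCosts hg)
    (hM.integrable_buyerPayment hg hint) (hM.integrable_alloc_mul_virtualCosts hg hint)

end Protocol.IsTruthful

end Truthful

/-! ### The anonymous virtual reserve mechanism -/

section Mechanism

variable {n : ℕ} {f g : Fin n → ℝ → ℝ} {c : Fin n → ℝ} {i : Fin n}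

lemma self_le_mechPrices (hf : ∀ i, IsNonnegDensity (f i))
    (hreg : ∀ i, StrictMonoOn (virtualValue (f i)) (supp (f i)))
    (hg : ∀ i, IsNonnegDensity (g i)) (c : Fin n → ℝ) (i : Fin n) :
    (c i : EReal) ≤ mechPrices f g c i := by
  have hcost : c i ≤ virtualReserve f (virtualCosts g c) + virtualCosts g c i :=
    ((hg i).self_le_virtualCost (c i)).trans
      (le_add_of_nonneg_left (isLeast_virtualReserve hf hreg _).1.1)
  exact (EReal.coe_le_coe_iff.2 hcost).trans ((hf i).self_le_virtualValueInv _)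

lemma measurable_mechPrices (hf : ∀ i, IsNonnegDensity (f i))
    (hreg : ∀ i, StrictMonoOn (virtualValue (f i)) (supp (f i)))
    (hg : ∀ i, IsNonnegDensity (g i)) : Measurable (mechPrices f g) :=
  measurable_pi_iff.2 fun i => monotone_virtualValueInv.measurable.comp
    (((continuous_virtualReserve hf hreg).measurable.comp (measurable_virtualCosts hg)).add
      ((measurable_pi_apply i).comp (measurable_virtualCosts hg)))

lemma measurable_saleProb_mechPrices (hf : ∀ i, IsNonnegDensity (f i))
    (hreg : ∀ i, StrictMonoOn (virtualValue (f i)) (supp (f i)))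
    (hg : ∀ i, IsNonnegDensity (g i)) (i : Fin n) :
    Measurable fun c => saleProb f (mechPrices f g c) i := by
  have := fun i => (hf i).isProbabilityMeasure
  exact (measurable_saleProb i).comp (measurable_mechPrices hf hreg hg)

lemma reserveMechanism_alloc (hf : ∀ i, IsNonnegDensity (f i))
    (hreg : ∀ i, StrictMonoOn (virtualValue (f i)) (supp (f i)))
    (hg : ∀ i, IsNonnegDensity (g i)) (c : Fin n → ℝ) (i : Fin n) :
    (reserveMechanism f g).alloc f c i = saleProb f (mechPrices f g c) i := by
  have := fun i => (hf i).isProbabilityMeasure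
  rw [Protocol.alloc_eq_integral ((measurable_mechPrices hf hreg hg).comp measurable_snd)]
  simp only [reserveMechanism, integral_const, probReal_univ, one_smul]

/-! ### Transfers of the reserve mechanism -/

lemma antitoneOn_saleProb_mechPrices (hf : ∀ i, IsNonnegDensity (f i))
    (hreg : ∀ i, StrictMonoOn (virtualValue (f i)) (supp (f i)))
    (hmono : ∀ i, MonotoneOn (virtualCost (g i)) (supp (g i))) (c : Fin n → ℝ) (i : Fin n) :
    AntitoneOn (fun u => saleProb f (mechPrices f g (Function.update c i u)) i)
      (supp (g i)) := by
  intro a ha b hb hab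
  have hvirtual : virtualCosts g (Function.update c i a) i ≤ virtualCost (g i) b := by
    simpa only [virtualCosts, Function.update_self] using hmono i ha hb hab
  have hsale := saleProb_reservePrices_update_le hf hreg _ hvirtual
  rwa [← virtualCosts_update, Function.update_idem] at hsale

lemma saleProb_mechPrices_le (hf : ∀ i, IsNonnegDensity (f i))
    (hreg : ∀ i, StrictMonoOn (virtualValue (f i)) (supp (f i)))
    (hg : ∀ i, IsNonnegDensity (g i)) (c : Fin n → ℝ) (i : Fin n) :
    saleProb f (mechPrices f g c) i ≤ (dist (f i)).real (Ici (c i)) := by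
  have := fun i => (hf i).isProbabilityMeasure
  rw [← (measurePreserving_eval (fun j => dist (f j)) i).measureReal_preimage
    measurableSet_Ici.nullMeasurableSet]
  exact measureReal_mono fun v hbuy => EReal.coe_le_coe_iff.1
    ((self_le_mechPrices hf hreg hg c i).trans (Buys.price_le hbuy))

lemma lintegral_saleProb_mechPrices_le (hf : ∀ i, IsNonnegDensity (f i))
    (hmean : ∀ i, Integrable fun z => z * f i z)
    (hreg : ∀ i, StrictMonoOn (virtualValue (f i)) (supp (f i)))
    (hg : ∀ i, IsNonnegDensity (g i)) (c : Fin n → ℝ) (i : Fin n) :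
    ∫⁻ u in supp (g i), ENNReal.ofReal (saleProb f (mechPrices f g (Function.update c i u)) i) ≤
      ENNReal.ofReal (∫ v, v ∂dist (f i)) := by
  have := (hf i).isProbabilityMeasure
  have htail (u : ℝ) : ENNReal.ofReal (saleProb f (mechPrices f g (Function.update c i u)) i) ≤
      dist (f i) (Ici u) := by
    refine ENNReal.ofReal_le_of_le_toReal ?_
    simpa only [Function.update_self, measureReal_def] using
      saleProb_mechPrices_le hf hreg hg (Function.update c i u) i
  calc ∫⁻ u in supp (g i), ENNReal.ofReal (saleProb f (mechPrices f g (Function.update c i u)) i)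
      ≤ ∫⁻ u in Ici 0, dist (f i) (Ici u) := (lintegral_mono htail).trans
        (lintegral_mono_set fun u hu => (hg i).nonneg_of_mem_supp hu)
    _ = ∫⁻ u in Ioi 0, dist (f i) (Ici u) := setLIntegral_congr Ioi_ae_eq_Ici.symm
    _ = ∫⁻ v, ENNReal.ofReal v ∂dist (f i) :=
        (lintegral_eq_lintegral_meas_le _ (hf i).ae_nonneg measurable_id.aemeasurable).symm
    _ = ENNReal.ofReal (∫ v, v ∂dist (f i)) :=
        (ofReal_integral_eq_lintegral_ofReal ((hf i).integrable_self (hmean i))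
          (hf i).ae_nonneg).symm

lemma integrableOn_saleProb_mechPrices (hf : ∀ i, IsNonnegDensity (f i))
    (hmean : ∀ i, Integrable fun z => z * f i z)
    (hreg : ∀ i, StrictMonoOn (virtualValue (f i)) (supp (f i)))
    (hg : ∀ i, IsNonnegDensity (g i)) (c : Fin n → ℝ) (i : Fin n) :
    IntegrableOn (fun u => saleProb f (mechPrices f g (Function.update c i u)) i)
      (supp (g i)) := by
  refine ⟨((measurable_saleProb_mechPrices hf hreg hg i).comp
    (measurable_update c)).aestronglyMeasurable, ?_⟩
  rw [hasFiniteIntegral_iff_ofReal (ae_of_all _ fun u => saleProb_nonneg f _ i)]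
  exact (lintegral_saleProb_mechPrices_le hf hmean hreg hg c i).trans_lt ENNReal.ofReal_lt_top

lemma ofReal_integral_saleProb_mechPrices (hf : ∀ i, IsNonnegDensity (f i))
    (hmean : ∀ i, Integrable fun z => z * f i z)
    (hreg : ∀ i, StrictMonoOn (virtualValue (f i)) (supp (f i)))
    (hg : ∀ i, IsNonnegDensity (g i)) (c : Fin n → ℝ) (i : Fin n) :
    ENNReal.ofReal (∫ u in supp (g i) ∩ Ioi (c i),
      saleProb f (mechPrices f g (Function.update c i u)) i) =
      rent g (fun c => saleProb f (mechPrices f g c) i) i c :=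
  ofReal_integral_eq_lintegral_ofReal
    ((integrableOn_saleProb_mechPrices hf hmean hreg hg c i).mono_set inter_subset_left)
    (ae_of_all _ fun _ => saleProb_nonneg f _ i)

lemma reserveMechanism_pay (hf : ∀ i, IsNonnegDensity (f i))
    (hreg : ∀ i, StrictMonoOn (virtualValue (f i)) (supp (f i)))
    (hmono : ∀ i, MonotoneOn (virtualCost (g i)) (supp (g i))) (hc : c i ∈ supp (g i)) :
    (reserveMechanism f g).pay c i = saleProb f (mechPrices f g c) i * c i +
      ∫ u in supp (g i) ∩ Ioi (c i), saleProb f (mechPrices f g (Function.update c i u)) i := by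
  simp only [reserveMechanism, sellerPrice]
  rcases eq_or_ne (saleProb f (mechPrices f g c) i) 0 with hunsold | hsold
  · -- A seller who is never chosen at `c i` is not chosen at higher costs either, so that the
    -- rent vanishes and dividing it by zero does no harm.
    have hrent : ∫ u in supp (g i) ∩ Ioi (c i),
        saleProb f (mechPrices f g (Function.update c i u)) i = 0 := by
      refine setIntegral_eq_zero_of_forall_eq_zero fun u hu => ?_
      have hle := antitoneOn_saleProb_mechPrices hf hreg hmono c i hc hu.1 (le_of_lt hu.2)
      simp only [Function.update_eq_self, hunsold] at hle
      exact hle.antisymm (saleProb_nonneg f _ i)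
    rw [hunsold, hrent, zero_mul, zero_mul, add_zero]
  · rw [mul_add, mul_div_cancel₀ _ hsold]

lemma measurable_reserveMechanism_pay (hf : ∀ i, IsNonnegDensity (f i))
    (hmean : ∀ i, Integrable fun z => z * f i z)
    (hreg : ∀ i, StrictMonoOn (virtualValue (f i)) (supp (f i)))
    (hg : ∀ i, IsNonnegDensity (g i)) : Measurable (reserveMechanism f g).pay := by
  refine measurable_pi_iff.2 fun i => ?_
  have hsale := measurable_saleProb_mechPrices hf hreg hg i
  have hrent (c : Fin n → ℝ) : ∫ u in supp (g i) ∩ Ioi (c i),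
      saleProb f (mechPrices f g (Function.update c i u)) i =
        (rent g (fun c => saleProb f (mechPrices f g c) i) i c).toReal := by
    rw [← ofReal_integral_saleProb_mechPrices hf hmean hreg hg,
      ENNReal.toReal_ofReal (integral_nonneg fun _ => saleProb_nonneg f _ i)]
  simp only [reserveMechanism, sellerPrice, hrent]
  exact hsale.mul ((measurable_pi_apply i).add
    ((measurable_rent (hg i) hsale).ennreal_toReal.div hsale))

lemma reserveMechanism_pay_nonneg (hf : ∀ i, IsNonnegDensity (f i))
    (hreg : ∀ i, StrictMonoOn (virtualValue (f i)) (supp (f i)))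
    (hg : ∀ i, IsNonnegDensity (g i))
    (hmono : ∀ i, MonotoneOn (virtualCost (g i)) (supp (g i))) (hc : c i ∈ supp (g i)) :
    0 ≤ (reserveMechanism f g).pay c i := by
  rw [reserveMechanism_pay hf hreg hmono hc]
  exact add_nonneg (mul_nonneg (saleProb_nonneg f _ i) ((hg i).nonneg_of_mem_supp hc))
    (integral_nonneg fun _ => saleProb_nonneg f _ i)

lemma reserveMechanism_pay_le (hf : ∀ i, IsNonnegDensity (f i))
    (hmean : ∀ i, Integrable fun z => z * f i z)
    (hreg : ∀ i, StrictMonoOn (virtualValue (f i)) (supp (f i)))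
    (hg : ∀ i, IsNonnegDensity (g i))
    (hmono : ∀ i, MonotoneOn (virtualCost (g i)) (supp (g i))) (hc : c i ∈ supp (g i)) :
    (reserveMechanism f g).pay c i ≤ ∫ v, v ∂dist (f i) + ∫ v, v ∂dist (f i) := by
  have := (hf i).isProbabilityMeasure
  have hmarkov : c i * (dist (f i)).real (Ici (c i)) ≤ ∫ v, v ∂dist (f i) :=
    mul_meas_ge_le_integral_of_nonneg (hf i).ae_nonneg ((hf i).integrable_self (hmean i)) (c i)
  rw [reserveMechanism_pay hf hreg hmono hc, mul_comm]
  refine add_le_add ((mul_le_mul_of_nonneg_left (saleProb_mechPrices_le hf hreg hg c i)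
    ((hg i).nonneg_of_mem_supp hc)).trans hmarkov) ?_
  rw [← ENNReal.ofReal_le_ofReal_iff (integral_nonneg_of_ae (hf i).ae_nonneg),
    ofReal_integral_saleProb_mechPrices hf hmean hreg hg]
  exact (lintegral_mono_set inter_subset_left).trans
    (lintegral_saleProb_mechPrices_le hf hmean hreg hg c i)

lemma integrable_reserveMechanism_pay (hf : ∀ i, IsNonnegDensity (f i))
    (hmean : ∀ i, Integrable fun z => z * f i z)
    (hreg : ∀ i, StrictMonoOn (virtualValue (f i)) (supp (f i)))
    (hg : ∀ i, IsNonnegDensity (g i))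
    (hmono : ∀ i, MonotoneOn (virtualCost (g i)) (supp (g i))) (i : Fin n) :
    Integrable (fun c => (reserveMechanism f g).pay c i) (jointDist g) := by
  have := fun i => (hg i).isProbabilityMeasure
  refine .of_bound ((measurable_pi_apply i).comp
    (measurable_reserveMechanism_pay hf hmean hreg hg)).aestronglyMeasurable
    (∫ v, v ∂dist (f i) + ∫ v, v ∂dist (f i)) ?_
  filter_upwards [ae_forall_mem_supp hg] with c hc
  rw [Real.norm_of_nonneg (reserveMechanism_pay_nonneg hf hreg hg hmono (hc i))]
  exact reserveMechanism_pay_le hf hmean hreg hg hmono (hc i)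

/-! ### Truthfulness and revenue of the reserve mechanism -/

lemma integrable_reserveMechanism_buyerPayment (hf : ∀ i, IsNonnegDensity (f i))
    (hmean : ∀ i, Integrable fun z => z * f i z)
    (hreg : ∀ i, StrictMonoOn (virtualValue (f i)) (supp (f i)))
    (hg : ∀ i, IsNonnegDensity (g i)) :
    Integrable (reserveMechanism f g).buyerPayment (outcomeDist f g) := by
  have := fun i => (hf i).isProbabilityMeasure
  have := fun i => (hg i).isProbabilityMeasure
  refine (integrable_sum_abs_values fun i => (hf i).integrable_self (hmean i)).mono'
    (Protocol.measurable_buyerPayment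
      ((measurable_mechPrices hf hreg hg).comp measurable_snd)).aestronglyMeasurable
    (ae_of_all _ fun q => ?_)
  rw [Real.norm_of_nonneg (Protocol.buyerPayment_nonneg
    (fun _ _ i => (hf i).virtualValueInv_nonneg _) q)]
  exact Protocol.buyerPayment_le (fun _ _ i => (hf i).virtualValueInv_ne_bot _) q

theorem reserveMechanism_isTruthful (hf : ∀ i, IsNonnegDensity (f i))
    (hmean : ∀ i, Integrable fun z => z * f i z)
    (hreg : ∀ i, StrictMonoOn (virtualValue (f i)) (supp (f i)))
    (hg : ∀ i, IsNonnegDensity (g i))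
    (hmono : ∀ i, MonotoneOn (virtualCost (g i)) (supp (g i))) :
    (reserveMechanism f g).IsTruthful f g where
  measurable_price := (measurable_mechPrices hf hreg hg).comp measurable_snd
  measurable_pay := measurable_reserveMechanism_pay hf hmean hreg hg
  price_ne_bot _ _ i := (hf i).virtualValueInv_ne_bot _
  integrable_profit := by
    have := fun i => (hf i).isProbabilityMeasure
    have := fun i => (hg i).isProbabilityMeasure
    exact (integrable_reserveMechanism_buyerPayment hf hmean hreg hg).sub
      (integrable_finsetSum _ fun i _ =>
        measurePreserving_outcomeDist_costs.integrable_comp_of_integrable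
          (integrable_reserveMechanism_pay hf hmean hreg hg hmono i))
  dominant c hc i b hb := by
    have hic := isIncentiveCompatible_setIntegral_inter_Ioi (S := supp (g i)) (hg i).ordConnected
      (antitoneOn_saleProb_mechPrices hf hreg hmono c i)
      (integrableOn_saleProb_mechPrices hf hmean hreg hg c i) (c i) (hc i) b hb
    have hpay := reserveMechanism_pay hf hreg hmono (c := Function.update c i b) (i := i)
      (by rwa [Function.update_self])
    simp only [Function.update_self, Function.update_idem] at hic hpay
    simp only [Protocol.sellerUtility, reserveMechanism_alloc hf hreg hg, hpay,
      reserveMechanism_pay hf hreg hmono (hc i)]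
    linarith
  participation c hc i := by
    rw [Protocol.sellerUtility, reserveMechanism_alloc hf hreg hg,
      reserveMechanism_pay hf hreg hmono (hc i), add_sub_cancel_left]
    exact integral_nonneg fun _ => saleProb_nonneg f _ i

lemma integral_reserveMechanism_pay_le (hf : ∀ i, IsNonnegDensity (f i))
    (hmean : ∀ i, Integrable fun z => z * f i z)
    (hreg : ∀ i, StrictMonoOn (virtualValue (f i)) (supp (f i)))
    (hg : ∀ i, IsNonnegDensity (g i))
    (hmono : ∀ i, MonotoneOn (virtualCost (g i)) (supp (g i))) (i : Fin n) :
    ∫ c, (reserveMechanism f g).pay c i ∂jointDist g ≤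
      ∫ c, (reserveMechanism f g).alloc f c i * virtualCosts g c i ∂jointDist g := by
  have := fun i => (hf i).isProbabilityMeasure
  have := fun i => (hg i).isProbabilityMeasure
  have hcost := (reserveMechanism_isTruthful hf hmean hreg hg hmono
    ).integrable_alloc_mul_virtualCosts hg (fun i => (hf i).integrable_self (hmean i)) i
  simp only [reserveMechanism_alloc hf hreg hg] at hcost ⊢
  refine integral_le_integral_of_lintegral_ofReal_le
    (integrable_reserveMechanism_pay hf hmean hreg hg hmono i).1
    ((ae_forall_mem_supp hg).mono fun c hc =>
      reserveMechanism_pay_nonneg hf hreg hg hmono (hc i))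
    hcost (ae_mul_virtualCosts_nonneg hg (fun c => saleProb_nonneg f _ i) i) ?_
  rw [← lintegral_cost_add_rent hg (measurable_saleProb_mechPrices hf hreg hg i)
    (fun c => saleProb_nonneg f _ i) i]
  refine lintegral_mono_ae ((ae_forall_mem_supp hg).mono fun c hc => ?_)
  rw [reserveMechanism_pay hf hreg hmono (hc i),
    ← ofReal_integral_saleProb_mechPrices hf hmean hreg hg]
  exact ENNReal.ofReal_add_le

theorem reserveMechanism_isApproximation (hf : ∀ i, IsNonnegDensity (f i))
    (hmean : ∀ i, Integrable fun z => z * f i z)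
    (hreg : ∀ i, StrictMonoOn (virtualValue (f i)) (supp (f i)))
    (hg : ∀ i, IsNonnegDensity (g i))
    (hmono : ∀ i, MonotoneOn (virtualCost (g i)) (supp (g i))) :
    (reserveMechanism f g).IsApproximation f g (1 / 2) := by
  have := fun i => (hf i).isProbabilityMeasure
  have := fun i => (hg i).isProbabilityMeasure
  have hint := fun i => (hf i).integrable_self (hmean i)
  have hR := reserveMechanism_isTruthful hf hmean hreg hg hmono
  refine ⟨hR, fun M hM => ?_⟩
  have hrevenue : M.revenue f g ≤
      ∫ s, pricingProfit f (virtualCosts g s.2) (M.price s.1 s.2) ∂reportDist g := by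
    rw [hM.revenue_eq hg hint]
    exact add_le_of_nonpos_right (Finset.sum_nonpos fun i _ =>
      sub_nonpos.2 (hM.integral_alloc_mul_virtualCosts_le hg hint i))
  have hreserve : ∫ s, pricingProfit f (virtualCosts g s.2) (mechPrices f g s.2) ∂reportDist g ≤
      (reserveMechanism f g).revenue f g := by
    rw [hR.revenue_eq hg hint]
    exact le_add_of_nonneg_right (Finset.sum_nonneg fun i _ =>
      sub_nonneg.2 (integral_reserveMechanism_pay_le hf hmean hreg hg hmono i))
  calc 1 / 2 * M.revenue f g
      ≤ 1 / 2 * ∫ s, pricingProfit f (virtualCosts g s.2) (M.price s.1 s.2) ∂reportDist g := by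
        gcongr
    _ ≤ ∫ s, pricingProfit f (virtualCosts g s.2) (mechPrices f g s.2) ∂reportDist g := by
        rw [← integral_const_mul]
        exact integral_mono ((hM.integrable_pricingProfit hg hint).const_mul _)
          (hR.integrable_pricingProfit hg hint) fun s =>
            half_mul_pricingProfit_le hf hreg _ hmean (hM.price_ne_bot _ _)
    _ ≤ (reserveMechanism f g).revenue f g := hreserve

end Mechanism

end Intermediation

theorem mainTheorem6_general (n : ℕ) (f g : Fin n → ℝ → ℝ)
    (hf : ∀ i, Intermediation.IsNonnegDensity (f i))
    (hmean : ∀ i, Integrable fun z => z * f i z)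
    (hreg : ∀ i, StrictMonoOn (Intermediation.virtualValue (f i)) (Intermediation.supp (f i)))
    (hg : ∀ i, Intermediation.IsNonnegDensity (g i))
    (hmono : ∀ i, MonotoneOn (Intermediation.virtualCost (g i)) (Intermediation.supp (g i))) :
    (∀ θ : Fin n → ℝ, ∀ p : Fin n → EReal, (∀ i, p i ≠ ⊥) →
      1 / 2 * Intermediation.pricingProfit f θ p ≤
        Intermediation.pricingProfit f θ (Intermediation.reservePrices f θ)) ∧
    (∀ θ : Fin n → ℝ, ∀ i, ∀ t, θ i ≤ t →
      Intermediation.saleProb f (Intermediation.reservePrices f (Function.update θ i t)) i ≤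
        Intermediation.saleProb f (Intermediation.reservePrices f θ) i) ∧
    (Intermediation.reserveMechanism f g).IsApproximation f g (1 / 2) :=
  ⟨fun θ _ hp => Intermediation.half_mul_pricingProfit_le hf hreg θ hmean hp,
    fun θ _ _ ht => Intermediation.saleProb_reservePrices_update_le hf hreg θ ht,
    Intermediation.reserveMechanism_isApproximation hf hmean hreg hg hmono⟩

theorem mainTheorem6 (n : ℕ)
    -- densities of the values and of the costs
    (f g : Fin n → ℝ → ℝ)
    (hf : ∀ i, Intermediation.IsNonnegDensity (f i))
    -- finite mean and strict regularity of the values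
    (hmean : ∀ i, Integrable fun z => z * f i z)
    (hreg : ∀ i, StrictMonoOn (Intermediation.virtualValue (f i)) (Intermediation.supp (f i)))
    (hg : ∀ i, Intermediation.IsNonnegDensity (g i))
    -- the negated costs have monotone hazard rates
    (hMHR : ∀ i, Intermediation.HasMHR fun z => g i (-z)) :
    -- a half-approximation to the algorithmic pricing problem, for all item costs
    (∀ θ : Fin n → ℝ, ∀ p : Fin n → EReal, (∀ i, p i ≠ ⊥) →
      1 / 2 * Intermediation.pricingProfit f θ p ≤
        Intermediation.pricingProfit f θ (Intermediation.reservePrices f θ)) ∧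
    -- monotonicity in the (virtual) cost of each seller
    (∀ θ : Fin n → ℝ, ∀ i, ∀ t, θ i ≤ t →
      Intermediation.saleProb f (Intermediation.reservePrices f (Function.update θ i t)) i ≤
        Intermediation.saleProb f (Intermediation.reservePrices f θ) i) ∧
    -- a half-approximation to the intermediation problem
    (Intermediation.reserveMechanism f g).IsApproximation f g (1 / 2) :=
  mainTheorem6_general n f g hf hmean hreg hg fun i => (hg i).monotoneOn_virtualCost (hMHR i)
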